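/- Let $\mathbf u:\mathbb R^3\to\mathbb R^3$ be a weak Beltrami flow, that is, $\mathbf u\in W^{1,3/2}_{loc}(\mathbb R^3,\mathbb R^3)$ and, with weak derivatives, $\operatorname{curl}\mathbf u\times\mathbf u=\mathbf 0$ and $\operatorname{div}\mathbf u=0$ almost everywhere in $\mathbb R^3$. For $x\ne \mathbf 0$ let $\mathbf u_N=\left(\mathbf u\cdot\frac{x}{|x|}\right)\frac{x}{|x|}$ and $\mathbf u_T=\mathbf u-\mathbf u_N$ be the normal and tangential parts of $\mathbf u$, and let $B_r=\{x\in\mathbb R^3:|x|<r\}$. Then the integrals below converge absolutely, and each of the following quantities is a non-decreasing function of $R$ on the indicated range: $$E_1(R)=\frac1R\int_{B_{2R}\setminus\overline{B_R}}\left(|\mathbf u_T|^2-|\mathbf u_N|^2\right)dx\qquad(R>0),$$ $$E_2(R)=\frac1{\ln R}\int_{B_R\setminus\overline{B_1}}\frac{|\mathbf u_T|^2-|\mathbf u_N|^2}{|x|}\,dx\qquad(R>1),$$ $$E_3(R)=\frac1{\ln^{1-\beta}R}\int_{B_R\setminus\overline{B_e}}\frac{|\mathbf u_T|^2-|\mathbf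 u_N|^2}{|x|\ln^{\beta}|x|}\,dx\qquad(R>e),\quad\text{for every }\beta\in(-\infty,1),$$ $$E_4(R)=\frac1{\ln\ln R}\int_{B_R\setminus\overline{B_e}}\frac{|\mathbf u_T|^2-|\mathbf u_N|^2}{|x|\ln|x|}\,dx\qquad(R>e).$$ -/

import Mathlib

open MeasureTheory Set Metric
open scoped ENNReal ContDiff Matrix

noncomputable section

namespace Beltrami

/-- Three-dimensional Euclidean space. -/
abbrev E3 : Type := EuclideanSpace ℝ (Fin 3)

/-- `f ∈ L^p_loc(ℝ³)`. -/
def MemLpLoc (f : E3 → ℝ) (p : ℝ≥0∞) : Prop :=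
  ∀ K : Set E3, IsCompact K → MemLp f p (volume.restrict K)

/-- `g` is the weak partial derivative `∂_j f` on `ℝ³`: both functions are locally integrable and
`∫ f ∂_j φ = - ∫ g φ` for every smooth compactly supported `φ`. -/
def HasWeakPartial (j : Fin 3) (f g : E3 → ℝ) : Prop :=
  LocallyIntegrable f ∧ LocallyIntegrable g ∧
    ∀ φ : E3 → ℝ, ContDiff ℝ ∞ φ → HasCompactSupport φ →
      ∫ x, f x * fderiv ℝ φ x (EuclideanSpace.single j 1) = - ∫ x, g x * φ x

/-- `u ∈ W^{1,p}_loc(ℝ³, ℝ³)` and `D` is its weak Jacobian matrix, `D x i j = ∂_j u_i (x)`. -/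
structure IsW1pLocWith (p : ℝ≥0∞) (u : E3 → E3) (D : E3 → Matrix (Fin 3) (Fin 3) ℝ) : Prop where
  memLpLoc : ∀ i, MemLpLoc (fun x => u x i) p
  memLpLoc_deriv : ∀ i j, MemLpLoc (fun x => D x i j) p
  hasWeakPartial : ∀ i j, HasWeakPartial j (fun x => u x i) (fun x => D x i j)

/-- The curl read off a Jacobian matrix `J i j = ∂_j u_i`. -/
def curlOf (J : Matrix (Fin 3) (Fin 3) ℝ) : Fin 3 → ℝ :=
  ![J 2 1 - J 1 2, J 0 2 - J 2 0, J 1 0 - J 0 1]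

/-- The divergence read off a Jacobian matrix `J i j = ∂_j u_i`. -/
def divOf (J : Matrix (Fin 3) (Fin 3) ℝ) : ℝ := ∑ i, J i i

/-- Weak Beltrami flow: `u ∈ W^{1,3/2}_loc(ℝ³, ℝ³)` with `curl u × u = 0` and `div u = 0` almost
everywhere, the derivatives being weak derivatives. -/
def IsWeakBeltrami (u : E3 → E3) : Prop :=
  ∃ D : E3 → Matrix (Fin 3) (Fin 3) ℝ, IsW1pLocWith (3 / 2) u D ∧
    (∀ᵐ x, crossProduct (curlOf (D x)) (u x).ofLp = 0) ∧
    (∀ᵐ x, divOf (D x) = 0)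

/-- Normal part `u_N = (u · x/|x|) x/|x|`. -/
def normalPart (u : E3 → E3) (x : E3) : E3 :=
  inner ℝ (u x) (‖x‖⁻¹ • x) • (‖x‖⁻¹ • x)

/-- Tangential part `u_T = u - u_N`. -/
def tangentialPart (u : E3 → E3) (x : E3) : E3 :=
  u x - normalPart u x

/-- `|u_T|² - |u_N|²`. -/
def gap (u : E3 → E3) (x : E3) : ℝ :=
  ‖tangentialPart u x‖ ^ 2 - ‖normalPart u x‖ ^ 2

/-- The annulus `B_b(0) \ closure B_a(0)`. -/
def annulus (a b : ℝ) : Set E3 := ball 0 b \ closedBall 0 a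

def energy1 (u : E3 → E3) (R : ℝ) : ℝ :=
  1 / R * ∫ x in annulus R (2 * R), gap u x

def energy2 (u : E3 → E3) (R : ℝ) : ℝ :=
  1 / Real.log R * ∫ x in annulus 1 R, gap u x / ‖x‖

def energy3 (u : E3 → E3) (β R : ℝ) : ℝ :=
  1 / Real.log R ^ (1 - β) *
    ∫ x in annulus (Real.exp 1) R, gap u x / (‖x‖ * Real.log ‖x‖ ^ β)

def energy4 (u : E3 → E3) (R : ℝ) : ℝ :=
  1 / Real.log (Real.log R) *
    ∫ x in annulus (Real.exp 1) R, gap u x / (‖x‖ * Real.log ‖x‖)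

end Beltrami

end

/-! The tensor `u ⊗ u - |u|²/2` has divergence `(div u) u + curl u × u = 0`. The exponent 3/2 is
what makes this meaningful: `W^{1,3/2}_loc` embeds in `L^3_loc` (`memLp_three_of_hasWeakPartial`),
so `u_i ∂_k u_j` is locally integrable by Hölder and the Leibniz rule `HasWeakPartial.mul` holds,
which gives `integral_stress_eq_zero`.

Testing against radial fields `f(|x|) x` and applying Fubini yields, with `m(s) = ∫_{B_s} |u|²`, the
identity `∫_{a<|x|<b} gap(x) w(|x|) dx = ∫_a^b w(s) m(s)/s ds` (`integral_annulus_gap_mul_eq`).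

For `w = 1` the bound `gap ≤ |u|²` gives `∫_a^b m(s)/s ds ≤ m(b) - m(a)`, an integrated form of `m/s
≤ m'`; hence `m(s)/s` is non-decreasing (`IsWeakBeltrami.monotoneOn_mass_div`). By the identity,
`E_1`, `E_2` and `E_4` are weighted averages of `m(s)/s`, and `E_3` is such an average times a
non-negative non-decreasing factor. -/

namespace Beltrami

open Filter Topology Convolution

/-! ### Mollification in `L^p` -/

section Mollification

variable {E : Type*} [NormedAddCommGroup E] [NormedSpace ℝ E] [FiniteDimensional ℝ E]
  [MeasurableSpace E] [BorelSpace E] {μ : Measure E} [μ.IsAddHaarMeasure]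

/-- Jensen's inequality for the probability measure whose density is the normalized bump, in the
form of monotonicity of `L^q` norms in the exponent. -/
theorem enorm_normed_convolution_rpow_le (φ : ContDiffBump (0 : E)) {q : ℝ} (hq : 1 ≤ q)
    {f : E → ℝ} (hf : AEStronglyMeasurable f μ) (x : E) :
    ‖(φ.normed μ ⋆[ContinuousLinearMap.lsmul ℝ ℝ, μ] f) x‖ₑ ^ q ≤
      ∫⁻ t, ENNReal.ofReal (φ.normed μ t) * ‖f (x - t)‖ₑ ^ q ∂μ := by
  have hρm : Measurable fun t => ENNReal.ofReal (φ.normed μ t) :=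
    (φ.continuous_normed.measurable).ennreal_ofReal
  set ν := μ.withDensity (fun t => ENNReal.ofReal (φ.normed μ t)) with hν
  have hprob : IsProbabilityMeasure ν := by
    constructor
    rw [hν, withDensity_apply _ MeasurableSet.univ, Measure.restrict_univ,
      ← ofReal_integral_eq_lintegral_ofReal φ.integrable_normed
        (Eventually.of_forall φ.nonneg_normed), φ.integral_normed, ENNReal.ofReal_one]
  have hfx : AEStronglyMeasurable (fun t => f (x - t)) μ :=
    hf.comp_quasiMeasurePreserving (quasiMeasurePreserving_sub_left μ x)
  have hfν : AEStronglyMeasurable (fun t => f (x - t)) ν :=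
    hfx.mono_ac (withDensity_absolutelyContinuous _ _)
  have hwd : ∀ g : E → ℝ≥0∞, AEMeasurable g μ →
      ∫⁻ t, g t ∂ν = ∫⁻ t, ENNReal.ofReal (φ.normed μ t) * g t ∂μ := fun g hg => by
    rw [hν, lintegral_withDensity_eq_lintegral_mul₀ hρm.aemeasurable hg]; rfl
  have h1 : ‖(φ.normed μ ⋆[ContinuousLinearMap.lsmul ℝ ℝ, μ] f) x‖ₑ ≤
      ∫⁻ t, ‖f (x - t)‖ₑ ∂ν := by
    rw [hwd _ hfx.enorm]
    refine (enorm_integral_le_lintegral_enorm _).trans (lintegral_mono fun t => ?_)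
    simp only [ContinuousLinearMap.lsmul_apply, smul_eq_mul, enorm_mul]
    rw [Real.enorm_of_nonneg (φ.nonneg_normed t)]
  have h2 := eLpNorm'_le_eLpNorm'_of_exponent_le (p := 1) (q := q) one_pos hq ν hfν
  simp only [eLpNorm', ENNReal.rpow_one, one_div, inv_one] at h2
  calc _ ≤ (∫⁻ t, ‖f (x - t)‖ₑ ∂ν) ^ q := by gcongr
    _ ≤ ((∫⁻ t, ‖f (x - t)‖ₑ ^ q ∂ν) ^ q⁻¹) ^ q := by gcongr
    _ = _ := by
      rw [← ENNReal.rpow_mul, inv_mul_cancel₀ (by positivity), ENNReal.rpow_one,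
        hwd _ (hfx.enorm.pow_const q)]

/-- The Young inequality for mollification. -/
theorem eLpNorm_normed_convolution_le (φ : ContDiffBump (0 : E)) {p : ℝ≥0∞} (hp : 1 ≤ p)
    (hp' : p ≠ ⊤) {f : E → ℝ} (hf : AEStronglyMeasurable f μ) :
    eLpNorm (φ.normed μ ⋆[ContinuousLinearMap.lsmul ℝ ℝ, μ] f) p μ ≤ eLpNorm f p μ := by
  have hp0 : p ≠ 0 := (one_pos.trans_le hp).ne'
  have hq : 1 ≤ p.toReal := by
    rw [← ENNReal.toReal_one]; exact ENNReal.toReal_mono hp' hp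
  have hρm : Measurable fun t => ENNReal.ofReal (φ.normed μ t) :=
    (φ.continuous_normed.measurable).ennreal_ofReal
  rw [eLpNorm_eq_lintegral_rpow_enorm_toReal hp0 hp',
    eLpNorm_eq_lintegral_rpow_enorm_toReal hp0 hp']
  refine ENNReal.rpow_le_rpow ?_ (by positivity)
  -- Jensen's bound is integrated in `x`; after Tonelli, translation invariance removes the shift
  -- and the kernel has total mass one.
  calc _ ≤ ∫⁻ x, ∫⁻ t, ENNReal.ofReal (φ.normed μ t) * ‖f (x - t)‖ₑ ^ p.toReal ∂μ ∂μ :=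
        lintegral_mono fun x => enorm_normed_convolution_rpow_le φ hq hf x
    _ = ∫⁻ t, ∫⁻ x, ENNReal.ofReal (φ.normed μ t) * ‖f (x - t)‖ₑ ^ p.toReal ∂μ ∂μ := by
        apply lintegral_lintegral_swap
        apply AEMeasurable.mul
        · exact (hρm.comp measurable_snd).aemeasurable
        · exact ((hf.comp_quasiMeasurePreserving
            (quasiMeasurePreserving_sub_of_right_invariant μ μ)).enorm).pow_const _
    _ = ∫⁻ t, ENNReal.ofReal (φ.normed μ t) * ∫⁻ x, ‖f x‖ₑ ^ p.toReal ∂μ ∂μ := by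
        refine lintegral_congr fun t => ?_
        rw [lintegral_const_mul' _ _ ENNReal.ofReal_ne_top,
          lintegral_sub_right_eq_self (fun x => ‖f x‖ₑ ^ p.toReal) t]
    _ = _ := by
        rw [lintegral_mul_const _ hρm,
          ← ofReal_integral_eq_lintegral_ofReal φ.integrable_normed
            (Eventually.of_forall φ.nonneg_normed), φ.integral_normed, ENNReal.ofReal_one, one_mul]

theorem aestronglyMeasurable_normed_convolution (φ : ContDiffBump (0 : E))
    {f : E → ℝ} (hf : LocallyIntegrable f μ) :
    AEStronglyMeasurable (φ.normed μ ⋆[ContinuousLinearMap.lsmul ℝ ℝ, μ] f) μ :=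
  (φ.hasCompactSupport_normed.continuous_convolution_left _ φ.continuous_normed
    hf).aestronglyMeasurable

/-- Uniform continuity makes the convergence uniform, and once the radii are below 1 the differences
live in one compact set of finite measure. -/
theorem tendsto_eLpNorm_normed_convolution_sub_of_continuous {ι : Type*} {l : Filter ι}
    {φ : ι → ContDiffBump (0 : E)} (hφ : Tendsto (fun i => (φ i).rOut) l (𝓝 0)) {p : ℝ≥0∞}
    (hp' : p ≠ ⊤) {f : E → ℝ} (hf : Continuous f) (hfs : HasCompactSupport f) :
    Tendsto (fun i => eLpNorm
      ((φ i).normed μ ⋆[ContinuousLinearMap.lsmul ℝ ℝ, μ] f - f) p μ) l (𝓝 0) := by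
  rcases eq_or_ne p 0 with rfl | hp0
  · simpa using tendsto_const_nhds
  set K := cthickening 1 (tsupport f) with hK
  have hKc : IsCompact K := hfs.isCompact.cthickening
  have hμK : μ K ≠ ⊤ := hKc.measure_lt_top.ne
  have huc : UniformContinuous f := hfs.uniformContinuous_of_continuous hf
  rw [ENNReal.tendsto_nhds_zero]
  intro ε hε
  obtain ⟨δ, hδ, hδε⟩ : ∃ δ : ℝ, 0 < δ ∧
      μ K ^ (1 / p.toReal) * ENNReal.ofReal δ ≤ ε := by
    have : Tendsto (fun δ : ℝ => μ K ^ (1 / p.toReal) * ENNReal.ofReal δ) (𝓝[>] 0) (𝓝 0) := by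
      have h := ENNReal.Tendsto.const_mul (a := μ K ^ (1 / p.toReal))
        (ENNReal.tendsto_ofReal (tendsto_nhdsWithin_of_tendsto_nhds
          (tendsto_id (α := ℝ) (x := 𝓝 0)) (s := Ioi 0)))
        (Or.inr (ENNReal.rpow_ne_top_of_nonneg (by positivity) hμK))
      simpa using h
    have h2 := (ENNReal.tendsto_nhds_zero.1 this ε hε).and self_mem_nhdsWithin
    obtain ⟨δ, h⟩ := h2.exists
    exact ⟨δ, h.2, h.1⟩
  obtain ⟨η, hη, hηδ⟩ := Metric.uniformContinuous_iff.1 huc δ hδ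
  filter_upwards [hφ.eventually (gt_mem_nhds (lt_min one_pos hη))] with i hi
  have hdist : ∀ x, dist (((φ i).normed μ ⋆[ContinuousLinearMap.lsmul ℝ ℝ, μ] f) x) (f x) ≤ δ :=
    fun x => (φ i).dist_normed_convolution_le hf.aestronglyMeasurable fun y hy =>
      (hηδ (lt_of_lt_of_le (mem_ball.1 hy) (hi.le.trans (min_le_right _ _)))).le
  have hsupp : ∀ x, x ∉ K →
      ((φ i).normed μ ⋆[ContinuousLinearMap.lsmul ℝ ℝ, μ] f - f) x = 0 := by
    intro x hx
    have hball : ∀ y ∈ ball x (φ i).rOut, f y = 0 := by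
      intro y hy
      by_contra hne
      refine hx (mem_cthickening_of_dist_le x y 1 _ (subset_tsupport f hne) ?_)
      rw [dist_comm]
      exact (mem_ball.1 hy).le.trans (hi.le.trans (min_le_left _ _))
    have hx0 : f x = 0 := hball x (mem_ball_self (φ i).rOut_pos)
    rw [Pi.sub_apply, (φ i).normed_convolution_eq_right (fun y hy => by rw [hball y hy, hx0]),
      sub_self]
  have hle : ∀ x, ‖((φ i).normed μ ⋆[ContinuousLinearMap.lsmul ℝ ℝ, μ] f - f) x‖ ≤
      ‖K.indicator (fun _ => δ) x‖ := by
    intro x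
    by_cases hx : x ∈ K
    · rw [indicator_of_mem hx, Pi.sub_apply, ← dist_eq_norm, Real.norm_of_nonneg hδ.le]
      exact hdist x
    · rw [hsupp x hx, norm_zero]; positivity
  refine (eLpNorm_mono hle).trans ?_
  rw [eLpNorm_indicator_const hKc.isClosed.measurableSet hp0 hp', mul_comm,
    Real.enorm_of_nonneg hδ.le]
  exact hδε

/-- Mollifications of an `L^p` function converge to it in `L^p`. -/
theorem tendsto_eLpNorm_normed_convolution_sub {ι : Type*} {l : Filter ι}
    {φ : ι → ContDiffBump (0 : E)} (hφ : Tendsto (fun i => (φ i).rOut) l (𝓝 0)) {p : ℝ≥0∞}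
    (hp : 1 ≤ p) (hp' : p ≠ ⊤) {f : E → ℝ} (hf : MemLp f p μ) :
    Tendsto (fun i => eLpNorm
      ((φ i).normed μ ⋆[ContinuousLinearMap.lsmul ℝ ℝ, μ] f - f) p μ) l (𝓝 0) := by
  have hfl : LocallyIntegrable f μ := hf.locallyIntegrable hp
  rw [ENNReal.tendsto_nhds_zero]
  intro ε hε
  have hε3 : ε / 3 ≠ 0 := by
    rw [ne_eq, ENNReal.div_eq_zero_iff]; push Not; exact ⟨hε.ne', by norm_num⟩
  -- Density of `C_c` and an ε/3 argument: mollification is an `L^p` contraction, so mollifying `f -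
  -- g` costs no more than `f - g` itself.
  obtain ⟨g, hgs, hfg, hg, hgp⟩ := hf.exists_hasCompactSupport_eLpNorm_sub_le hp' hε3
  filter_upwards [ENNReal.tendsto_nhds_zero.1
    (tendsto_eLpNorm_normed_convolution_sub_of_continuous (μ := μ) hφ hp' hg hgs) (ε / 3)
      (pos_iff_ne_zero.2 hε3)] with i hi
  set J : (E → ℝ) → E → ℝ := fun f => (φ i).normed μ ⋆[ContinuousLinearMap.lsmul ℝ ℝ, μ] f
  have hgl : LocallyIntegrable g μ := hg.locallyIntegrable
  have hex : ∀ h : E → ℝ, LocallyIntegrable h μ →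
      ConvolutionExists ((φ i).normed μ) h (ContinuousLinearMap.lsmul ℝ ℝ) μ := fun h hh =>
    (φ i).hasCompactSupport_normed.convolutionExists_left _ (φ i).continuous_normed hh
  have hJ : J f = J (f - g) + J g := by
    have := (hex _ (hfl.sub hgl)).distrib_add (hex _ hgl)
    simpa [J] using this
  have heq : J f - f = J (f - g) + (J g - g) + (g - f) := by rw [hJ]; abel
  change eLpNorm (J f - f) p μ ≤ ε
  have m1 : AEStronglyMeasurable (J (f - g)) μ :=
    aestronglyMeasurable_normed_convolution (φ i) (hfl.sub hgl)
  have m2 : AEStronglyMeasurable (J g - g) μ :=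
    (aestronglyMeasurable_normed_convolution (φ i) hgl).sub hg.aestronglyMeasurable
  have m3 : AEStronglyMeasurable (g - f) μ := hg.aestronglyMeasurable.sub hf.1
  rw [heq]
  calc _ ≤ eLpNorm (J (f - g)) p μ + eLpNorm (J g - g) p μ + eLpNorm (g - f) p μ :=
        (eLpNorm_add_le (m1.add m2) m3 hp).trans (by gcongr; exact eLpNorm_add_le m1 m2 hp)
    _ ≤ ε / 3 + ε / 3 + ε / 3 := by
        gcongr
        · exact (eLpNorm_normed_convolution_le (φ i) hp hp' (hf.1.sub hg.aestronglyMeasurable)).trans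
            hfg
        · rw [eLpNorm_sub_comm]; exact hfg
    _ = ε := ENNReal.add_thirds ε

end Mollification

/-! ### Mollification and weak derivatives on `ℝ³` -/

/-- Mollification by a normalized bump function. -/
noncomputable def mollify (φ : ContDiffBump (0 : E3)) (f : E3 → ℝ) : E3 → ℝ :=
  φ.normed volume ⋆[ContinuousLinearMap.lsmul ℝ ℝ, volume] f

/-- A sequence of bump functions shrinking to the origin. -/
noncomputable def shrinkingBump (n : ℕ) : ContDiffBump (0 : E3) where
  rIn := 1 / ((n : ℝ) + 1) / 2
  rOut := 1 / ((n : ℝ) + 1)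
  rIn_pos := by positivity
  rIn_lt_rOut := half_lt_self (by positivity)

theorem tendsto_rOut_shrinkingBump :
    Tendsto (fun n => (shrinkingBump n).rOut) atTop (𝓝 0) :=
  tendsto_one_div_add_atTop_nhds_zero_nat

theorem contDiff_mollify (φ : ContDiffBump (0 : E3)) {f : E3 → ℝ} (hf : LocallyIntegrable f) :
    ContDiff ℝ ∞ (mollify φ f) :=
  φ.hasCompactSupport_normed.contDiff_convolution_left _ φ.contDiff_normed hf

theorem hasCompactSupport_mollify (φ : ContDiffBump (0 : E3)) {f : E3 → ℝ}
    (hf : HasCompactSupport f) : HasCompactSupport (mollify φ f) :=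
  φ.hasCompactSupport_normed.convolution _ hf

theorem eLpNorm_mollify_le (φ : ContDiffBump (0 : E3)) {p : ℝ≥0∞} (hp : 1 ≤ p)
    (hp' : p ≠ ⊤) {f : E3 → ℝ} (hf : AEStronglyMeasurable f) :
    eLpNorm (mollify φ f) p ≤ eLpNorm f p :=
  eLpNorm_normed_convolution_le φ hp hp' hf

theorem tendsto_eLpNorm_mollify_sub {p : ℝ≥0∞} (hp : 1 ≤ p) (hp' : p ≠ ⊤) {f : E3 → ℝ}
    (hf : MemLp f p) :
    Tendsto (fun n => eLpNorm (mollify (shrinkingBump n) f - f) p) atTop (𝓝 0) :=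
  tendsto_eLpNorm_normed_convolution_sub tendsto_rOut_shrinkingBump hp hp' hf

theorem ae_tendsto_mollify {f : E3 → ℝ} (hf : LocallyIntegrable f) :
    ∀ᵐ x, Tendsto (fun n => mollify (shrinkingBump n) f x) atTop (𝓝 (f x)) :=
  -- `K = 2` because the outer radius of `shrinkingBump` is exactly twice the inner one.
  ContDiffBump.ae_convolution_tendsto_right_of_locallyIntegrable (K := 2)
    tendsto_rOut_shrinkingBump
    (Eventually.of_forall fun n => by simp only [shrinkingBump]; linarith) hf

theorem mollify_apply (φ : ContDiffBump (0 : E3)) (f : E3 → ℝ) (x : E3) :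
    mollify φ f x = ∫ t, f t * φ.normed volume (x - t) := by
  rw [mollify, convolution_eq_swap]
  simp [mul_comm]

/-- Mollification turns weak partial derivatives into classical ones. -/
theorem fderiv_mollify (φ : ContDiffBump (0 : E3)) {k : Fin 3} {f g : E3 → ℝ}
    (h : HasWeakPartial k f g) (x : E3) :
    fderiv ℝ (mollify φ f) x (EuclideanSpace.single k 1) = mollify φ g x := by
  set e : E3 := EuclideanSpace.single k 1
  set ρ : E3 → ℝ := φ.normed volume with hρ
  have hρc : ContDiff ℝ ∞ ρ := φ.contDiff_normed
  have hρ1 : ContDiff ℝ 1 ρ := φ.contDiff_normed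
  have hρs : HasCompactSupport ρ := φ.hasCompactSupport_normed
  have hd := hρs.hasFDerivAt_convolution_left
    (ContinuousLinearMap.lsmul ℝ ℝ) hρ1 h.1 x
  have hex := (hρs.fderiv ℝ).convolutionExists_left
    ((ContinuousLinearMap.lsmul ℝ ℝ).precompL E3 : (E3 →L[ℝ] ℝ) →L[ℝ] ℝ →L[ℝ] E3 →L[ℝ] ℝ)
    (hρ1.continuous_fderiv one_ne_zero) h.1 x
  rw [mollify, hd.fderiv, convolution_def, ContinuousLinearMap.integral_apply hex.integrable]
  have hψc : ContDiff ℝ ∞ (fun t => ρ (x - t)) := hρc.comp (contDiff_const.sub contDiff_id)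
  have hψs : HasCompactSupport (fun t => ρ (x - t)) :=
    hρs.comp_homeomorph (Homeomorph.subLeft x)
  -- The reflected kernel `t ↦ ρ (x - t)` is the test function; the sign of its derivative cancels
  -- the sign in the definition of weak partials.
  have hψd : ∀ t, fderiv ℝ (fun t => ρ (x - t)) t e = - fderiv ℝ ρ (x - t) e := by
    intro t
    have h1 : HasFDerivAt (fun t : E3 => x - t) (-ContinuousLinearMap.id ℝ E3) t :=
      (hasFDerivAt_id t).const_sub x
    have h2 := ((hρ1.differentiable one_ne_zero (x - t)).hasFDerivAt).comp t h1
    rw [show (fun t => ρ (x - t)) = ρ ∘ (fun t => x - t) from rfl, h2.fderiv]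
    simp
  have key := h.2.2 _ hψc hψs
  simp only [e] at hψd
  simp only [hψd, mul_neg, integral_neg, neg_inj] at key
  rw [mollify_apply, ← key, ← integral_sub_left_eq_self _ volume x]
  refine integral_congr_ae (Eventually.of_forall fun t => ?_)
  simp [ContinuousLinearMap.precompL_apply, mul_comm, e]

theorem norm_le_sum_norm_single (L : E3 →L[ℝ] ℝ) :
    ‖L‖ ≤ ∑ k, ‖L (EuclideanSpace.single k 1)‖ := by
  refine L.opNorm_le_bound (by positivity) fun v => ?_
  have hv : v = ∑ k, v k • EuclideanSpace.single k (1 : ℝ) := by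
    ext i; simp [Finset.sum_apply, Pi.single_apply]
  conv_lhs => rw [hv]
  rw [map_sum, Finset.sum_mul]
  refine (norm_sum_le _ _).trans (Finset.sum_le_sum fun k _ => ?_)
  rw [map_smul, norm_smul, mul_comm]
  gcongr
  exact PiLp.norm_apply_le v k

theorem eLpNorm_fderiv_mollify_le (φ : ContDiffBump (0 : E3)) {p : ℝ≥0∞} (hp : 1 ≤ p)
    (hp' : p ≠ ⊤) {f : E3 → ℝ} {g : Fin 3 → E3 → ℝ} (h : ∀ k, HasWeakPartial k f (g k)) :
    eLpNorm (fderiv ℝ (mollify φ f)) p ≤ ∑ k, eLpNorm (g k) p := by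
  have h1 : eLpNorm (fderiv ℝ (mollify φ f)) p ≤
      eLpNorm (∑ k, fun x => ‖mollify φ (g k) x‖) p := by
    refine eLpNorm_mono fun x => ?_
    refine (norm_le_sum_norm_single _).trans ?_
    rw [Finset.sum_apply, Real.norm_of_nonneg (by positivity)]
    simp [fderiv_mollify _ (h _)]
  refine h1.trans ((eLpNorm_sum_le (fun k _ =>
    (contDiff_mollify φ (h k).2.1).continuous.norm.aestronglyMeasurable) hp).trans ?_)
  refine Finset.sum_le_sum fun k _ => ?_
  rw [eLpNorm_norm]
  exact eLpNorm_mollify_le _ hp hp' (h k).2.1.aestronglyMeasurable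

/-! ### The Sobolev embedding `W^{1,3/2} ⊂ L^3` -/

theorem one_le_three_halves : (1 : ℝ≥0∞) ≤ 3 / 2 := by
  rw [ENNReal.le_div_iff_mul_le (by simp) (by simp)]; norm_num

theorem three_halves_ne_top : (3 / 2 : ℝ≥0∞) ≠ ⊤ := ENNReal.div_ne_top (by simp) (by simp)

/-- The Gagliardo-Nirenberg-Sobolev inequality with exponents `3/2` and `3`. -/
theorem exists_eLpNorm_three_le_fderiv : ∃ C : NNReal, ∀ F : E3 → ℝ, ContDiff ℝ 1 F →
    HasCompactSupport F → eLpNorm F 3 ≤ C * eLpNorm (fderiv ℝ F) (3 / 2) := by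
  have h32 : (3 / 2 : ℝ≥0∞) = ((3 / 2 : NNReal) : ℝ≥0∞) := by
    rw [ENNReal.coe_div (by norm_num)]; simp
  have h3 : (3 : ℝ≥0∞) = ((3 : NNReal) : ℝ≥0∞) := by simp
  refine ⟨eLpNormLESNormFDerivOfEqInnerConst (volume : Measure E3) ((3 / 2 : NNReal) : ℝ),
    fun F hF hFs => ?_⟩
  rw [h32, h3]
  exact eLpNorm_le_eLpNorm_fderiv_of_eq_inner (volume : Measure E3) hF hFs
    (by rw [le_div_iff₀] <;> norm_num) (by simp) (by simp; norm_num)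

/-- Sobolev embedding `W^{1,3/2} ⊂ L^3` for compactly supported functions. -/
theorem memLp_three_of_hasWeakPartial {f : E3 → ℝ} {g : Fin 3 → E3 → ℝ}
    (hfs : HasCompactSupport f) (hg : ∀ k, MemLp (g k) (3 / 2))
    (h : ∀ k, HasWeakPartial k f (g k)) : MemLp f 3 := by
  have hfl : LocallyIntegrable f := (h 0).1
  obtain ⟨C, hC⟩ := exists_eLpNorm_three_le_fderiv
  -- The Sobolev bound is uniform in `n`, since mollification does not increase the norm of the weak
  -- gradient; Fatou then transfers it to `f`.
  have hbound : ∀ n, eLpNorm (mollify (shrinkingBump n) f) 3 ≤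
      C * ∑ k, eLpNorm (g k) (3 / 2) := by
    intro n
    set F := mollify (shrinkingBump n) f with hF
    have hFc : ContDiff ℝ 1 F := (contDiff_mollify _ hfl).of_le (by exact_mod_cast le_top)
    have hFs : HasCompactSupport F := hasCompactSupport_mollify _ hfs
    refine (hC F hFc hFs).trans ?_
    exact mul_le_mul' le_rfl (eLpNorm_fderiv_mollify_le _ one_le_three_halves
      three_halves_ne_top h)
  refine ⟨hfl.aestronglyMeasurable, ?_⟩
  refine (Lp.eLpNorm_lim_le_liminf_eLpNorm (fun n =>
    (contDiff_mollify (shrinkingBump n) hfl).continuous.aestronglyMeasurable) f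
      (ae_tendsto_mollify hfl)).trans_lt ?_
  refine lt_of_le_of_lt (liminf_le_of_le (h := fun b hb => ?_) (by isBoundedDefault))
    (b := C * ∑ k, eLpNorm (g k) (3 / 2)) ?_
  · obtain ⟨n, hn⟩ := hb.exists
    exact hn.trans (hbound n)
  · exact ENNReal.mul_lt_top ENNReal.coe_lt_top
      (ENNReal.sum_lt_top.2 fun k _ => (hg k).2)

/-! ### Leibniz rules and localization -/

theorem locallyIntegrable_continuous_mul {f η : E3 → ℝ} (hf : LocallyIntegrable f)
    (hη : Continuous η) : LocallyIntegrable (fun x => η x * f x) := by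
  rw [locallyIntegrable_iff] at hf ⊢
  exact fun K hK => (hf K hK).continuousOn_mul hη.continuousOn hK

theorem integrable_mul_of_hasCompactSupport {f η : E3 → ℝ} (hf : LocallyIntegrable f)
    (hη : Continuous η) (hηs : HasCompactSupport η) : Integrable (fun x => f x * η x) := by
  have := hf.integrable_smul_left_of_hasCompactSupport hη hηs
  simpa [mul_comm] using this

theorem continuous_fderiv_apply {φ : E3 → ℝ} (hφ : ContDiff ℝ ∞ φ) (v : E3) :
    Continuous fun x => fderiv ℝ φ x v :=
  (hφ.continuous_fderiv (by simp)).clm_apply continuous_const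

theorem hasCompactSupport_fderiv_apply {φ : E3 → ℝ} (hφ : HasCompactSupport φ) (v : E3) :
    HasCompactSupport fun x => fderiv ℝ φ x v :=
  hφ.fderiv_apply (𝕜 := ℝ) v

/-- Leibniz rule for the product of a smooth function and a weakly differentiable one. -/
theorem HasWeakPartial.smooth_mul {k : Fin 3} {f g η : E3 → ℝ} (h : HasWeakPartial k f g)
    (hη : ContDiff ℝ ∞ η) :
    HasWeakPartial k (fun x => η x * f x)
      (fun x => η x * g x + fderiv ℝ η x (EuclideanSpace.single k 1) * f x) := by
  have hdη := continuous_fderiv_apply hη (EuclideanSpace.single k 1)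
  refine ⟨locallyIntegrable_continuous_mul h.1 hη.continuous,
    (locallyIntegrable_continuous_mul h.2.1 hη.continuous).add
      (locallyIntegrable_continuous_mul h.1 hdη), fun φ hφ hφs => ?_⟩
  have hdφ := continuous_fderiv_apply hφ (EuclideanSpace.single k 1)
  have hdφs := hasCompactSupport_fderiv_apply hφs (EuclideanSpace.single k 1)
  have key := h.2.2 (fun x => η x * φ x) (hη.mul hφ) hφs.mul_left
  have hd : ∀ x, fderiv ℝ (fun x => η x * φ x) x (EuclideanSpace.single k 1) =
      η x * fderiv ℝ φ x (EuclideanSpace.single k 1) +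
        φ x * fderiv ℝ η x (EuclideanSpace.single k 1) := by
    intro x
    rw [fderiv_fun_mul (hη.differentiable (by simp) x) (hφ.differentiable (by simp) x)]
    simp
  have i1 : Integrable fun x => f x * (η x * fderiv ℝ φ x (EuclideanSpace.single k 1)) :=
    integrable_mul_of_hasCompactSupport h.1 (hη.continuous.mul hdφ) hdφs.mul_left
  have i2 : Integrable fun x => f x * (φ x * fderiv ℝ η x (EuclideanSpace.single k 1)) :=
    integrable_mul_of_hasCompactSupport h.1 (hφ.continuous.mul hdη) hφs.mul_right
  have i3 : Integrable fun x => g x * (η x * φ x) :=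
    integrable_mul_of_hasCompactSupport h.2.1 (hη.continuous.mul hφ.continuous) hφs.mul_left
  simp only [hd, mul_add] at key
  rw [integral_add i1 i2] at key
  have e1 : ∫ x, η x * f x * fderiv ℝ φ x (EuclideanSpace.single k 1) =
      ∫ x, f x * (η x * fderiv ℝ φ x (EuclideanSpace.single k 1)) := by
    congr 1; ext x; ring
  have e2 : ∫ x, (η x * g x + fderiv ℝ η x (EuclideanSpace.single k 1) * f x) * φ x =
      (∫ x, g x * (η x * φ x)) +
        ∫ x, f x * (φ x * fderiv ℝ η x (EuclideanSpace.single k 1)) := by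
    rw [← integral_add i3 i2]; congr 1; ext x; ring
  rw [e1, e2]; linarith

theorem MemLpLoc.memLp_mul {f η : E3 → ℝ} {p : ℝ≥0∞} (hf : MemLpLoc f p)
    (hη : Continuous η) (hηs : HasCompactSupport η) : MemLp (fun x => η x * f x) p := by
  have h1 : MemLp ((tsupport η).indicator f) p :=
    (memLp_indicator_iff_restrict (isClosed_tsupport η).measurableSet).2 (hf _ hηs.isCompact)
  obtain ⟨C, hC⟩ := hηs.exists_bound_of_continuous hη
  refine h1.of_le_mul (c := C) ?_ (Eventually.of_forall fun x => ?_)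
  · have : (fun x => η x * f x) = fun x => η x * (tsupport η).indicator f x := by
      ext x
      by_cases hx : x ∈ tsupport η
      · rw [indicator_of_mem hx]
      · rw [image_eq_zero_of_notMem_tsupport hx, zero_mul, zero_mul]
    rw [this]
    exact hη.aestronglyMeasurable.mul h1.1
  · by_cases hx : x ∈ tsupport η
    · rw [indicator_of_mem hx, norm_mul]
      exact mul_le_mul_of_nonneg_right (hC x) (norm_nonneg _)
    · rw [image_eq_zero_of_notMem_tsupport hx, indicator_of_notMem hx]; simp

/-- A function in `W^{1,3/2}_loc` agrees on any given ball with a function in `W^{1,3/2} ∩ L^3`. -/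
theorem exists_eqOn_ball_memLp {f : E3 → ℝ} {g : Fin 3 → E3 → ℝ} (hf : MemLpLoc f (3 / 2))
    (hg : ∀ k, MemLpLoc (g k) (3 / 2)) (h : ∀ k, HasWeakPartial k f (g k)) {R : ℝ} (hR : 0 < R) :
    ∃ (f' : E3 → ℝ) (g' : Fin 3 → E3 → ℝ), MemLp f' 3 ∧ MemLp f' (3 / 2) ∧
      (∀ k, MemLp (g' k) (3 / 2)) ∧ (∀ k, HasWeakPartial k f' (g' k)) ∧
      (∀ x ∈ ball (0 : E3) R, f' x = f x) ∧ ∀ k, ∀ x ∈ ball (0 : E3) R, g' k x = g k x := by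
  let b : ContDiffBump (0 : E3) := ⟨R, R + 1, hR, by linarith⟩
  have hb : ContDiff ℝ ∞ b := b.contDiff
  have hbs : HasCompactSupport b := b.hasCompactSupport
  have h1 : ∀ k, HasWeakPartial k (fun x => b x * f x) _ := fun k => (h k).smooth_mul hb
  have h2 : ∀ k, MemLp (fun x => b x * g k x +
      fderiv ℝ b x (EuclideanSpace.single k 1) * f x) (3 / 2) := fun k =>
    ((hg k).memLp_mul hb.continuous hbs).add
      (hf.memLp_mul (continuous_fderiv_apply hb _) (hasCompactSupport_fderiv_apply hbs _))
  refine ⟨fun x => b x * f x, _, memLp_three_of_hasWeakPartial hbs.mul_right h2 h1,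
    hf.memLp_mul hb.continuous hbs, h2, h1, fun x hx => ?_, fun k x hx => ?_⟩
  · simp only [b.one_of_mem_closedBall (ball_subset_closedBall hx), one_mul]
  -- The cut-off is constant near `x`, so its gradient contributes nothing inside the ball.
  · have he : (b : E3 → ℝ) =ᶠ[𝓝 x] 1 := b.eventuallyEq_one_of_mem_ball hx
    rw [b.one_of_mem_closedBall (ball_subset_closedBall hx), one_mul, he.fderiv_eq]
    simp

theorem holderTriple_three_three_halves : ENNReal.HolderTriple 3 (3 / 2) 1 := by
  refine ⟨?_⟩
  rw [ENNReal.inv_div (by simp) (by simp), inv_one, ← one_div, ENNReal.div_add_div_same]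
  norm_num
  exact ENNReal.div_self (by simp) (by simp)

theorem tendsto_integral_mul_of_eLpNorm {p q : ℝ≥0∞} [ENNReal.HolderTriple p q 1]
    {a : ℕ → E3 → ℝ} {a₀ b : E3 → ℝ} (ha : ∀ n, MemLp (a n) p) (ha₀ : MemLp a₀ p)
    (hb : MemLp b q) (h : Tendsto (fun n => eLpNorm (a n - a₀) p) atTop (𝓝 0)) :
    Tendsto (fun n => ∫ x, a n x * b x) atTop (𝓝 (∫ x, a₀ x * b x)) := by
  refine tendsto_integral_of_L1' (fun x => a₀ x * b x)
    (hb.mul' ha₀ : MemLp _ 1 _).1 (Eventually.of_forall fun n =>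
      memLp_one_iff_integrable.1 (hb.mul' (ha n))) ?_
  have hle : ∀ n, eLpNorm ((fun x => a n x * b x) - fun x => a₀ x * b x) 1 ≤
      eLpNorm (a n - a₀) p * eLpNorm b q := by
    intro n
    have : ((fun x => a n x * b x) - fun x => a₀ x * b x) = (a n - a₀) • b := by
      ext x; simp [sub_mul]
    rw [this]
    exact eLpNorm_smul_le_mul_eLpNorm hb.1 ((ha n).1.sub ha₀.1)
  refine tendsto_of_tendsto_of_tendsto_of_le_of_le tendsto_const_nhds ?_ (fun _ => zero_le) hle
  simpa using ENNReal.Tendsto.mul_const h (Or.inr hb.2.ne)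

/-- Leibniz rule for functions in `W^{1,3/2} ∩ L^3`. -/
theorem HasWeakPartial.mul_of_memLp {k : Fin 3} {f₁ g₁ f₂ g₂ : E3 → ℝ}
    (h₁ : HasWeakPartial k f₁ g₁) (h₂ : HasWeakPartial k f₂ g₂)
    (hf₁ : MemLp f₁ 3) (hg₁ : MemLp g₁ (3 / 2)) (hf₂ : MemLp f₂ 3) (hf₂' : MemLp f₂ (3 / 2))
    (hg₂ : MemLp g₂ (3 / 2)) :
    HasWeakPartial k (fun x => f₁ x * f₂ x) (fun x => f₁ x * g₂ x + g₁ x * f₂ x) := by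
  have := holderTriple_three_three_halves
  have : ENNReal.HolderTriple (3 / 2) 3 1 := ENNReal.HolderTriple.symm
  have I1 : Integrable fun x => f₁ x * f₂ x := memLp_one_iff_integrable.1 (hf₂'.mul' hf₁)
  have I2 : Integrable fun x => f₁ x * g₂ x := memLp_one_iff_integrable.1 (hg₂.mul' hf₁)
  have I3 : Integrable fun x => g₁ x * f₂ x := memLp_one_iff_integrable.1 (hf₂.mul' hg₁)
  refine ⟨I1.locallyIntegrable, (I2.add I3).locallyIntegrable, fun φ hφ hφs => ?_⟩
  have hdφ := continuous_fderiv_apply hφ (EuclideanSpace.single k 1)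
  have hdφs := hasCompactSupport_fderiv_apply hφs (EuclideanSpace.single k 1)
  set dφ := fun x => fderiv ℝ φ x (EuclideanSpace.single k 1) with hdφ_def
  have mulφ : ∀ {w ψ : E3 → ℝ} {p : ℝ≥0∞}, MemLp w p → Continuous ψ → HasCompactSupport ψ →
      MemLp (fun x => ψ x * w x) p := fun hw hψ hψs =>
    MemLpLoc.memLp_mul (fun K _ => hw.restrict K) hψ hψs
  have m3 : ∀ n, MemLp (mollify (shrinkingBump n) f₁) 3 := fun n =>
    ⟨(contDiff_mollify _ h₁.1).continuous.aestronglyMeasurable,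
      (eLpNorm_mollify_le _ (by norm_num) (by simp) hf₁.1).trans_lt hf₁.2⟩
  have m32 : ∀ n, MemLp (mollify (shrinkingBump n) g₁) (3 / 2) := fun n =>
    ⟨(contDiff_mollify _ h₁.2.1).continuous.aestronglyMeasurable,
      (eLpNorm_mollify_le _ one_le_three_halves three_halves_ne_top hg₁.1).trans_lt hg₁.2⟩
  have t3 := tendsto_eLpNorm_mollify_sub (by norm_num) (by simp) hf₁
  have t32 := tendsto_eLpNorm_mollify_sub one_le_three_halves three_halves_ne_top hg₁
  -- Each pairing has exponents 3 and 3/2 in some order: `L1` uses `f₂ ∈ L^{3/2}` against `f₁ ∈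
  -- L^3`, while `L3` uses `f₂ ∈ L^3` against `g₁ ∈ L^{3/2}`.
  have L1 := tendsto_integral_mul_of_eLpNorm m3 hf₁ (mulφ hf₂' hdφ hdφs) t3
  have L2 := tendsto_integral_mul_of_eLpNorm m3 hf₁ (mulφ hg₂ hφ.continuous hφs) t3
  have L3 := tendsto_integral_mul_of_eLpNorm m32 hg₁ (mulφ hf₂ hφ.continuous hφs) t32
  have J2 : ∀ n, Integrable fun x => mollify (shrinkingBump n) f₁ x * (φ x * g₂ x) := fun n =>
    memLp_one_iff_integrable.1 ((mulφ hg₂ hφ.continuous hφs).mul' (m3 n))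
  have J3 : ∀ n, Integrable fun x => mollify (shrinkingBump n) g₁ x * (φ x * f₂ x) := fun n =>
    memLp_one_iff_integrable.1 ((mulφ hf₂ hφ.continuous hφs).mul' (m32 n))
  have K2 : Integrable fun x => f₁ x * (φ x * g₂ x) :=
    memLp_one_iff_integrable.1 ((mulφ hg₂ hφ.continuous hφs).mul' hf₁)
  have K3 : Integrable fun x => g₁ x * (φ x * f₂ x) :=
    memLp_one_iff_integrable.1 ((mulφ hf₂ hφ.continuous hφs).mul' hg₁)
  -- With `f₁` mollified this is the Leibniz rule with a smooth factor; the limit in `n` gives the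
  -- claim.
  have key : ∀ n, ∫ x, mollify (shrinkingBump n) f₁ x * (dφ x * f₂ x) =
      -((∫ x, mollify (shrinkingBump n) f₁ x * (φ x * g₂ x)) +
        ∫ x, mollify (shrinkingBump n) g₁ x * (φ x * f₂ x)) := by
    intro n
    have := (h₂.smooth_mul (contDiff_mollify (shrinkingBump n) h₁.1)).2.2 φ hφ hφs
    simp only [fderiv_mollify _ h₁] at this
    rw [← integral_add (J2 n) (J3 n)]
    convert! this using 2
    · ext x; simp only [hdφ_def]; ring
    · congr 1; ext x; ring
  have lim := tendsto_nhds_unique (L1.congr key) (L2.add L3).neg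
  rw [← integral_add K2 K3] at lim
  convert! lim using 2
  · ext x; simp only [hdφ_def]; ring
  · congr 1; ext x; ring

theorem exists_subset_ball_of_isCompact {K : Set E3} (hK : IsCompact K) :
    ∃ R : ℝ, 0 < R ∧ K ⊆ ball 0 R := by
  obtain ⟨R, hR⟩ := hK.isBounded.subset_ball 0
  exact ⟨max R 1, by positivity, hR.trans (ball_subset_ball (le_max_left _ _))⟩

/-- Leibniz rule in `W^{1,3/2}_loc`. -/
theorem HasWeakPartial.mul {f₁ f₂ : E3 → ℝ} {g₁ g₂ : Fin 3 → E3 → ℝ}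
    (hf₁ : MemLpLoc f₁ (3 / 2)) (hg₁ : ∀ k, MemLpLoc (g₁ k) (3 / 2))
    (h₁ : ∀ k, HasWeakPartial k f₁ (g₁ k))
    (hf₂ : MemLpLoc f₂ (3 / 2)) (hg₂ : ∀ k, MemLpLoc (g₂ k) (3 / 2))
    (h₂ : ∀ k, HasWeakPartial k f₂ (g₂ k)) (k : Fin 3) :
    HasWeakPartial k (fun x => f₁ x * f₂ x) (fun x => f₁ x * g₂ k x + g₁ k x * f₂ x) := by
  -- The weak identity only sees the functions on the support of the test function, so they may be
  -- replaced by their global `W^{1,3/2} ∩ L^3` substitutes.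
  have loc : ∀ K : Set E3, IsCompact K → ∃ F G : E3 → ℝ, HasWeakPartial k F G ∧
      (∀ x ∈ K, F x = f₁ x * f₂ x) ∧ ∀ x ∈ K, G x = f₁ x * g₂ k x + g₁ k x * f₂ x := by
    intro K hK
    obtain ⟨R, hR, hKR⟩ := exists_subset_ball_of_isCompact hK
    obtain ⟨f₁', g₁', a1, a2, a3, a4, a5, a6⟩ := exists_eqOn_ball_memLp hf₁ hg₁ h₁ hR
    obtain ⟨f₂', g₂', b1, b2, b3, b4, b5, b6⟩ := exists_eqOn_ball_memLp hf₂ hg₂ h₂ hR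
    refine ⟨_, _, (a4 k).mul_of_memLp (b4 k) a1 (a3 k) b1 b2 (b3 k), fun x hx => ?_,
      fun x hx => ?_⟩
    · rw [a5 x (hKR hx), b5 x (hKR hx)]
    · rw [a5 x (hKR hx), b5 x (hKR hx), a6 k x (hKR hx), b6 k x (hKR hx)]
  refine ⟨locallyIntegrable_iff.2 fun K hK => ?_, locallyIntegrable_iff.2 fun K hK => ?_,
    fun φ hφ hφs => ?_⟩
  · obtain ⟨F, G, h, hF, hG⟩ := loc K hK
    exact (h.1.integrableOn_isCompact hK).congr_fun hF hK.isClosed.measurableSet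
  · obtain ⟨F, G, h, hF, hG⟩ := loc K hK
    exact (h.2.1.integrableOn_isCompact hK).congr_fun hG hK.isClosed.measurableSet
  · obtain ⟨F, G, h, hF, hG⟩ := loc (tsupport φ) hφs.isCompact
    have key := h.2.2 φ hφ hφs
    convert! key using 2
    · ext x
      by_cases hx : x ∈ tsupport φ
      · rw [hF x hx]
      · have : fderiv ℝ φ x = 0 :=
          image_eq_zero_of_notMem_tsupport fun hx' => hx (tsupport_fderiv_subset ℝ hx')
        simp [this]
    · congr 1
      ext x
      by_cases hx : x ∈ tsupport φ
      · rw [hG x hx]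
      · simp [image_eq_zero_of_notMem_tsupport hx]

/-! ### The divergence-free stress tensor -/

theorem IsW1pLocWith.hasWeakPartial_mul {u : E3 → E3} {D : E3 → Matrix (Fin 3) (Fin 3) ℝ}
    (h : IsW1pLocWith (3 / 2) u D) (i j k : Fin 3) :
    HasWeakPartial k (fun x => u x i * u x j) (fun x => u x i * D x j k + D x i k * u x j) :=
  HasWeakPartial.mul (h.memLpLoc i) (h.memLpLoc_deriv i) (h.hasWeakPartial i) (h.memLpLoc j)
    (h.memLpLoc_deriv j) (h.hasWeakPartial j) k

/-- Pointwise, the divergence of `u ⊗ u - |u|²/2` is `(div u) u + curl u × u`. -/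
theorem sum_stress_eq_zero {J : Matrix (Fin 3) (Fin 3) ℝ} {v : Fin 3 → ℝ} (φ : Fin 3 → ℝ)
    (hc : crossProduct (curlOf J) v = 0) (hd : divOf J = 0) :
    ∑ i, ∑ j, ((v i * J j j + J i j * v j) * φ i -
      1 / 2 * ((v j * J j i + J j i * v j) * φ i)) = 0 := by
  have h0 := congrFun hc 0
  have h1 := congrFun hc 1
  have h2 := congrFun hc 2
  simp [crossProduct, curlOf] at h0 h1 h2
  simp only [divOf, Fin.sum_univ_three] at hd ⊢
  linear_combination φ 0 * h0 + φ 1 * h1 + φ 2 * h2 +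
    (v 0 * φ 0 + v 1 * φ 1 + v 2 * φ 2) * hd

/-- The tensor `u ⊗ u - |u|²/2` of a weak Beltrami flow is weakly divergence free. -/
theorem integral_stress_eq_zero {u : E3 → E3} (hu : IsWeakBeltrami u) {φ : Fin 3 → E3 → ℝ}
    (hφ : ∀ i, ContDiff ℝ ∞ (φ i)) (hφs : ∀ i, HasCompactSupport (φ i)) :
    ∫ x, ∑ i, ∑ j, (u x i * u x j * fderiv ℝ (φ i) x (EuclideanSpace.single j 1) -
      1 / 2 * (u x j * u x j * fderiv ℝ (φ i) x (EuclideanSpace.single i 1))) = 0 := by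
  obtain ⟨D, hD, hcurl, hdiv⟩ := hu
  have hw := hD.hasWeakPartial_mul
  have I1 : ∀ i j l k, Integrable fun x =>
      u x i * u x j * fderiv ℝ (φ l) x (EuclideanSpace.single k 1) := fun i j l k =>
    integrable_mul_of_hasCompactSupport (hw i j k).1 (continuous_fderiv_apply (hφ l) _)
      (hasCompactSupport_fderiv_apply (hφs l) _)
  have I2 : ∀ i j k l, Integrable fun x => (u x i * D x j k + D x i k * u x j) * φ l x :=
    fun i j k l => integrable_mul_of_hasCompactSupport (hw i j k).2.1 (hφ l).continuous (hφs l)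
  have hQ : ∀ i j, Integrable fun x => (u x i * D x j j + D x i j * u x j) * φ i x -
      1 / 2 * ((u x j * D x j i + D x j i * u x j) * φ i x) := fun i j =>
    (I2 i j j i).sub ((I2 j j i i).const_mul _)
  have hP : ∀ i j, Integrable fun x =>
      u x i * u x j * fderiv ℝ (φ i) x (EuclideanSpace.single j 1) -
      1 / 2 * (u x j * u x j * fderiv ℝ (φ i) x (EuclideanSpace.single i 1)) := fun i j =>
    (I1 i j i j).sub ((I1 j j i i).const_mul _)
  have hPQ : ∀ i j, ∫ x, (u x i * u x j * fderiv ℝ (φ i) x (EuclideanSpace.single j 1) -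
      1 / 2 * (u x j * u x j * fderiv ℝ (φ i) x (EuclideanSpace.single i 1))) =
      -∫ x, ((u x i * D x j j + D x i j * u x j) * φ i x -
      1 / 2 * ((u x j * D x j i + D x j i * u x j) * φ i x)) := by
    intro i j
    rw [integral_sub (I1 i j i j) ((I1 j j i i).const_mul _),
      integral_sub (I2 i j j i) ((I2 j j i i).const_mul _), integral_const_mul, integral_const_mul,
      (hw i j j).2.2 _ (hφ i) (hφs i), (hw j j i).2.2 _ (hφ i) (hφs i)]
    ring
  rw [integral_finsetSum _ fun i _ => integrable_finsetSum _ fun j _ => hP i j]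
  have : ∀ i, ∫ x, ∑ j, (u x i * u x j * fderiv ℝ (φ i) x (EuclideanSpace.single j 1) -
      1 / 2 * (u x j * u x j * fderiv ℝ (φ i) x (EuclideanSpace.single i 1))) =
      -∫ x, ∑ j, ((u x i * D x j j + D x i j * u x j) * φ i x -
      1 / 2 * ((u x j * D x j i + D x j i * u x j) * φ i x)) := by
    intro i
    rw [integral_finsetSum _ fun j _ => hP i j,
      integral_finsetSum _ fun j _ => hQ i j, ← Finset.sum_neg_distrib]
    exact Finset.sum_congr rfl fun j _ => hPQ i j
  rw [Finset.sum_congr rfl fun i _ => this i, Finset.sum_neg_distrib,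
    ← integral_finsetSum _ fun i _ => integrable_finsetSum _ fun j _ => hQ i j, neg_eq_zero]
  refine integral_eq_zero_of_ae ?_
  filter_upwards [hcurl, hdiv] with x hx1 hx2 using
    sum_stress_eq_zero (fun i => φ i x) hx1 hx2

/-! ### Pointwise form and integrability of the gap -/

theorem gap_eq (u : E3 → E3) (x : E3) :
    gap u x = ‖u x‖ ^ 2 - 2 * inner ℝ (u x) x ^ 2 / ‖x‖ ^ 2 := by
  rcases eq_or_ne x 0 with rfl | hx
  · simp [gap, tangentialPart, normalPart]
  have hx' : ‖x‖ ≠ 0 := norm_ne_zero_iff.2 hx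
  set e : E3 := ‖x‖⁻¹ • x
  have he : ‖e‖ = 1 := by simp [e, norm_smul, hx']
  have hue : inner ℝ (u x) e = inner ℝ (u x) x / ‖x‖ := by
    rw [inner_smul_right]; field_simp
  have hN : ‖normalPart u x‖ ^ 2 = inner ℝ (u x) e ^ 2 := by
    simp only [normalPart]
    rw [norm_smul, he, mul_one, Real.norm_eq_abs, sq_abs]
  have hT : ‖tangentialPart u x‖ ^ 2 = ‖u x‖ ^ 2 - inner ℝ (u x) e ^ 2 := by
    simp only [tangentialPart]
    rw [norm_sub_sq_real, hN]
    simp only [normalPart]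
    rw [inner_smul_right]
    ring
  rw [gap, hT, hN, hue]
  field_simp
  ring

theorem abs_gap_le (u : E3 → E3) (x : E3) : |gap u x| ≤ ‖u x‖ ^ 2 := by
  have h1 : 0 ≤ 2 * inner ℝ (u x) x ^ 2 / ‖x‖ ^ 2 := by positivity
  have h2 : inner ℝ (u x) x ^ 2 / ‖x‖ ^ 2 ≤ ‖u x‖ ^ 2 := by
    refine div_le_of_le_mul₀ (by positivity) (by positivity) ?_
    rw [← mul_pow, ← sq_abs]
    gcongr
    exact abs_real_inner_le_norm _ _
  rw [gap_eq, abs_le]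
  constructor <;> [skip; linarith]
  rw [mul_div_assoc]; linarith

theorem IsWeakBeltrami.aestronglyMeasurable {u : E3 → E3} (hu : IsWeakBeltrami u) :
    AEStronglyMeasurable u := by
  obtain ⟨D, hD, -⟩ := hu
  have h : AEMeasurable (fun x => WithLp.ofLp (u x)) :=
    aemeasurable_pi_iff.2 fun i => (hD.hasWeakPartial i 0).1.aestronglyMeasurable.aemeasurable
  exact ((MeasurableEquiv.toLp 2 (Fin 3 → ℝ)).measurable.comp_aemeasurable h).aestronglyMeasurable

theorem IsWeakBeltrami.locallyIntegrable_norm_sq {u : E3 → E3} (hu : IsWeakBeltrami u) :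
    LocallyIntegrable fun x => ‖u x‖ ^ 2 := by
  obtain ⟨D, hD, -⟩ := hu
  have : (fun x => ‖u x‖ ^ 2) = fun x => ∑ i, u x i * u x i := by
    ext x
    rw [EuclideanSpace.norm_sq_eq]
    exact Finset.sum_congr rfl fun i _ => by rw [Real.norm_eq_abs, sq_abs, sq]
  rw [this]
  exact locallyIntegrable_finsetSum _ fun i _ => (hD.hasWeakPartial_mul i i 0).1

theorem IsWeakBeltrami.locallyIntegrable_gap {u : E3 → E3} (hu : IsWeakBeltrami u) :
    LocallyIntegrable (gap u) := by
  refine hu.locallyIntegrable_norm_sq.mono ?_ (Eventually.of_forall fun x => ?_)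
  · have : gap u = fun x => ‖u x‖ ^ 2 - 2 * inner ℝ (u x) x ^ 2 / ‖x‖ ^ 2 := funext (gap_eq u)
    rw [this]
    have hm := hu.aestronglyMeasurable
    have h1 : AEStronglyMeasurable (fun x => inner ℝ (u x) x) :=
      hm.inner continuous_id.aestronglyMeasurable
    have h2 : AEMeasurable fun x => 2 * inner ℝ (u x) x ^ 2 / ‖x‖ ^ 2 :=
      ((h1.aemeasurable.pow_const 2).const_mul 2).div (measurable_norm.pow_const 2).aemeasurable
    exact (hm.norm.pow 2).sub h2.aestronglyMeasurable
  · rw [Real.norm_eq_abs, Real.norm_of_nonneg (by positivity)]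
    exact abs_gap_le u x

/-! ### Radial test fields -/

/-- The stress identity tested against the field `x ↦ G x • x` for a radial function `G`. -/
theorem integral_radial_eq_zero {u : E3 → E3} (hu : IsWeakBeltrami u) {G c : E3 → ℝ}
    (hG : ContDiff ℝ ∞ G) (hGs : HasCompactSupport G)
    (hc : ∀ x j, fderiv ℝ G x (EuclideanSpace.single j 1) = c x * x j) :
    ∫ x, (‖u x‖ ^ 2 * G x + gap u x * (c x * ‖x‖ ^ 2)) = 0 := by
  have hcoord : ∀ i, ContDiff ℝ ∞ (fun x : E3 => x i) := fun i =>
    (EuclideanSpace.proj (𝕜 := ℝ) i).contDiff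
  have key := integral_stress_eq_zero hu (φ := fun i x => x i * G x)
    (fun i => (hcoord i).mul hG) (fun i => hGs.mul_left)
  have hd : ∀ i j x, fderiv ℝ (fun x : E3 => x i * G x) x (EuclideanSpace.single j 1) =
      x i * (c x * x j) + G x * (if i = j then 1 else 0) := by
    intro i j x
    rw [fderiv_fun_mul ((hcoord i).differentiable (by simp) x) (hG.differentiable (by simp) x)]
    have : fderiv ℝ (fun x : E3 => x i) x = EuclideanSpace.proj (𝕜 := ℝ) i :=
      (EuclideanSpace.proj (𝕜 := ℝ) i).fderiv
    rw [this]
    simp [hc]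
  -- With `∂_j (x_i G) = G δ_ij + c x_i x_j`, the contraction is `G|u|² + c(u·x)² - |u|²(3G +
  -- c|x|²)/2`. In dimension three the `G` terms leave `-G|u|²/2`, whence the factor `-2`.
  have : ∀ x, ‖u x‖ ^ 2 * G x + gap u x * (c x * ‖x‖ ^ 2) =
      (-2) * ∑ i, ∑ j, (u x i * u x j *
        fderiv ℝ (fun x : E3 => x i * G x) x (EuclideanSpace.single j 1) -
      1 / 2 * (u x j * u x j *
        fderiv ℝ (fun x : E3 => x i * G x) x (EuclideanSpace.single i 1))) := by
    intro x
    have hg : gap u x * ‖x‖ ^ 2 = ‖u x‖ ^ 2 * ‖x‖ ^ 2 - 2 * inner ℝ (u x) x ^ 2 := by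
      rcases eq_or_ne x 0 with rfl | hx
      · simp
      have hx' : ‖x‖ ≠ 0 := norm_ne_zero_iff.2 hx
      rw [gap_eq]; field_simp
    have h1 : ∀ v : E3, ‖v‖ ^ 2 = v 0 ^ 2 + v 1 ^ 2 + v 2 ^ 2 := fun v => by
      rw [EuclideanSpace.norm_sq_eq]; simp [Fin.sum_univ_three]
    have h2 : inner ℝ (u x) x = u x 0 * x 0 + u x 1 * x 1 + u x 2 * x 2 := by
      rw [PiLp.inner_apply]; simp [Fin.sum_univ_three, mul_comm]
    rw [show gap u x * (c x * ‖x‖ ^ 2) = c x * (gap u x * ‖x‖ ^ 2) by ring, hg]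
    simp only [hd, h1, h2, Fin.sum_univ_three]
    simp
    ring
  simp only [this]
  rw [integral_const_mul, key, mul_zero]

/-- The mass `∫_{B_s} |u|²`. -/
noncomputable def mass (u : E3 → E3) (s : ℝ) : ℝ := ∫ x in ball (0 : E3) s, ‖u x‖ ^ 2

section Primitive

variable {k : ℝ → ℝ} {a b : ℝ}

theorem hasDerivAt_tail (hk : Continuous k) (b r : ℝ) :
    HasDerivAt (fun r => ∫ s in r..b, k s) (-k r) r :=
  intervalIntegral.integral_hasDerivAt_left (hk.intervalIntegrable _ _)
    (hk.stronglyMeasurableAtFilter _ _) hk.continuousAt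

theorem contDiff_tail (hk : ContDiff ℝ ∞ k) (b : ℝ) :
    ContDiff ℝ ∞ (fun r => ∫ s in r..b, k s) := by
  refine contDiff_infty_iff_deriv.2
    ⟨fun r => (hasDerivAt_tail hk.continuous b r).differentiableAt, ?_⟩
  have : deriv (fun r => ∫ s in r..b, k s) = fun r => -k r :=
    funext fun r => (hasDerivAt_tail hk.continuous b r).deriv
  rw [this]
  exact hk.neg

theorem tail_eq_of_le (hk : Continuous k) (hka : ∀ s, s ≤ a → k s = 0) {r : ℝ} (hr : r ≤ a) :
    ∫ s in r..b, k s = ∫ s in a..b, k s := by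
  rw [← intervalIntegral.integral_add_adjacent_intervals (b := a) (hk.intervalIntegrable _ _)
    (hk.intervalIntegrable _ _)]
  rw [intervalIntegral.integral_zero_ae, zero_add]
  refine Eventually.of_forall fun s hs => hka s ?_
  rw [uIoc_of_le hr] at hs
  exact hs.2

/-- Writing the tail over the whole line prepares Fubini; for `r > b` both sides vanish. -/
theorem tail_eq_integral (hkb : ∀ s, b ≤ s → k s = 0) (r : ℝ) :
    ∫ s in r..b, k s = ∫ s, (Ioi r).indicator k s := by
  rw [integral_indicator measurableSet_Ioi]
  rcases le_total r b with h | h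
  · rw [intervalIntegral.integral_of_le h]
    refine (setIntegral_eq_of_subset_of_forall_sdiff_eq_zero measurableSet_Ioi
      (fun s hs => hs.1) fun s hs => hkb s ?_).symm
    by_contra hlt
    exact hs.2 ⟨hs.1, (not_le.1 hlt).le⟩
  · rw [intervalIntegral.integral_zero_ae, setIntegral_eq_zero_of_forall_eq_zero]
    · exact fun s hs => hkb s (h.trans (le_of_lt hs))
    · refine Eventually.of_forall fun s hs => hkb s ?_
      rw [uIoc_of_ge h] at hs
      exact hs.1.le

end Primitive

theorem hasFDerivAt_norm_of_ne_zero {x : E3} (hx : x ≠ 0) :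
    HasFDerivAt (fun x : E3 => ‖x‖) (‖x‖⁻¹ • innerSL ℝ x) x := by
  have hx' : ‖x‖ ≠ 0 := norm_ne_zero_iff.2 hx
  have h := (hasStrictFDerivAt_norm_sq x).hasFDerivAt.sqrt (pow_ne_zero 2 hx')
  simp only [Real.sqrt_sq (norm_nonneg _)] at h
  convert! h using 1
  ext v
  simp
  field_simp

/-- The Fubini hypothesis: since `k` vanishes beyond `b`, only `|u|²` on the ball of radius `b`
matters, and there it is integrable. -/
theorem integrable_prod_indicator {u : E3 → E3} (hu : IsWeakBeltrami u) {k : ℝ → ℝ}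
    {b : ℝ} (hk : Continuous k) (hks : HasCompactSupport k) (hkb : ∀ s, b ≤ s → k s = 0) :
    Integrable (fun p : E3 × ℝ => ‖u p.1‖ ^ 2 * (Ioi ‖p.1‖).indicator k p.2)
      (volume.prod volume) := by
  have h1 : Integrable ((ball (0 : E3) b).indicator fun x => ‖u x‖ ^ 2) :=
    (integrable_indicator_iff measurableSet_ball).2
      ((hu.locallyIntegrable_norm_sq.integrableOn_isCompact
        (isCompact_closedBall 0 b)).mono_set ball_subset_closedBall)
  have h2 := h1.mul_prod (hk.integrable_of_hasCompactSupport hks (μ := volume))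
  have hset : MeasurableSet {p : E3 × ℝ | ‖p.1‖ < p.2} :=
    measurableSet_lt (measurable_norm.comp measurable_fst) measurable_snd
  have heq : (fun p : E3 × ℝ => ‖u p.1‖ ^ 2 * (Ioi ‖p.1‖).indicator k p.2) =
      {p : E3 × ℝ | ‖p.1‖ < p.2}.indicator
        fun p => (ball (0 : E3) b).indicator (fun x => ‖u x‖ ^ 2) p.1 * k p.2 := by
    ext p
    by_cases hp : ‖p.1‖ < p.2
    · rw [indicator_of_mem (s := Ioi _) hp,
        indicator_of_mem (s := {p : E3 × ℝ | ‖p.1‖ < p.2}) hp]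
      by_cases hb : p.1 ∈ ball (0 : E3) b
      · rw [indicator_of_mem hb]
      · rw [hkb p.2, mul_zero, mul_zero]
        rw [mem_ball_zero_iff, not_lt] at hb
        exact hb.trans hp.le
    · rw [indicator_of_notMem (s := Ioi _) hp,
        indicator_of_notMem (s := {p : E3 × ℝ | ‖p.1‖ < p.2}) hp, mul_zero]
  rw [heq]
  exact h2.indicator hset

/-- The radial identity for a smooth weight. -/
theorem integral_gap_mul_eq_of_contDiff {u : E3 → E3} (hu : IsWeakBeltrami u) {k : ℝ → ℝ}
    {a b : ℝ} (ha : 0 < a) (hk : ContDiff ℝ ∞ k) (hka : ∀ s, s ≤ a → k s = 0)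
    (hkb : ∀ s, b ≤ s → k s = 0) :
    ∫ x, gap u x * (‖x‖ * k ‖x‖) = ∫ s, k s * mass u s := by
  have hks : HasCompactSupport k := by
    refine HasCompactSupport.intro (isCompact_Icc (a := a) (b := b)) fun s hs => ?_
    rw [mem_Icc, not_and_or, not_le, not_le] at hs
    exact hs.elim (fun h => hka s h.le) fun h => hkb s h.le
  -- The primitive vanishing beyond `b`: `f(|x|)` has compact support and gradient `-(k(|x|)/|x|)
  -- x`.
  set f : ℝ → ℝ := fun r => ∫ s in r..b, k s with hf
  have hfc : ContDiff ℝ ∞ f := contDiff_tail hk b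
  have hfb : ∀ r, b ≤ r → f r = 0 := by
    intro r hr
    simp only [hf]
    rw [tail_eq_integral hkb, integral_eq_zero_of_ae]
    refine Eventually.of_forall fun s => ?_
    by_cases hs : s ∈ Ioi r
    · rw [indicator_of_mem hs]; exact hkb s (hr.trans (le_of_lt hs))
    · rw [indicator_of_notMem hs]; rfl
  -- Because `k` vanishes up to `a > 0`, `f(|x|)` is constant near the origin, where the norm is not
  -- smooth.
  have hnear : ∀ x : E3, ‖x‖ < a → (fun x : E3 => f ‖x‖) =ᶠ[𝓝 x] fun _ => f a := by
    intro x hx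
    filter_upwards [continuous_norm.continuousAt.eventually (gt_mem_nhds hx)] with y hy using
      tail_eq_of_le hk.continuous hka (le_of_lt hy)
  have hG : ContDiff ℝ ∞ fun x : E3 => f ‖x‖ := by
    refine contDiff_iff_contDiffAt.2 fun x => ?_
    rcases eq_or_ne x 0 with rfl | hx
    · exact contDiffAt_const.congr_of_eventuallyEq (hnear 0 (by simpa using ha))
    · exact hfc.contDiffAt.comp x (contDiffAt_norm ℝ hx)
  have hGs : HasCompactSupport fun x : E3 => f ‖x‖ := by
    refine HasCompactSupport.intro (isCompact_closedBall (0 : E3) b) fun x hx => ?_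
    rw [mem_closedBall_zero_iff, not_le] at hx
    exact hfb _ hx.le
  have hc : ∀ x j, fderiv ℝ (fun x : E3 => f ‖x‖) x (EuclideanSpace.single j 1) =
      (-(k ‖x‖ / ‖x‖)) * x j := by
    intro x j
    rcases eq_or_ne x 0 with rfl | hx
    · rw [(hnear 0 (by simpa using ha)).fderiv_eq]
      simp
    · have := (hasDerivAt_tail hk.continuous b ‖x‖).comp_hasFDerivAt x
        (hasFDerivAt_norm_of_ne_zero hx)
      rw [show (fun x : E3 => f ‖x‖) = f ∘ fun x => ‖x‖ from rfl, this.fderiv]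
      simp [EuclideanSpace.inner_single_right]
      ring
  have key := integral_radial_eq_zero hu hG hGs hc
  have hcx : ∀ x : E3, gap u x * (-(k ‖x‖ / ‖x‖) * ‖x‖ ^ 2) = -(gap u x * (‖x‖ * k ‖x‖)) := by
    intro x
    rcases eq_or_ne ‖x‖ 0 with h | h
    · rw [h]; simp
    · field_simp
  simp only [hcx] at key
  have i1 : Integrable fun x => ‖u x‖ ^ 2 * f ‖x‖ :=
    integrable_mul_of_hasCompactSupport hu.locallyIntegrable_norm_sq hG.continuous hGs
  have i2 : Integrable fun x => gap u x * (‖x‖ * k ‖x‖) := by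
    refine integrable_mul_of_hasCompactSupport (η := fun x => ‖x‖ * k ‖x‖)
      hu.locallyIntegrable_gap (continuous_norm.mul (hk.continuous.comp continuous_norm))
      (HasCompactSupport.intro (isCompact_closedBall (0 : E3) b) fun x hx => ?_)
    rw [mem_closedBall_zero_iff, not_le] at hx
    rw [hkb _ hx.le, mul_zero]
  rw [integral_add i1 i2.fun_neg, integral_neg] at key
  have h1 : ∫ x, gap u x * (‖x‖ * k ‖x‖) = ∫ x, ‖u x‖ ^ 2 * f ‖x‖ := by linarith
  rw [h1]
  -- Exchanging the integrals leaves, for each `s`, the integral of `|u|²` over `|x| < s`, which is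
  -- the mass.
  have h2 : ∀ x, ‖u x‖ ^ 2 * f ‖x‖ = ∫ s, ‖u x‖ ^ 2 * (Ioi ‖x‖).indicator k s := by
    intro x
    rw [integral_const_mul, ← tail_eq_integral hkb]
  simp only [h2]
  rw [integral_integral_swap (integrable_prod_indicator hu hk.continuous hks hkb)]
  congr 1
  ext s
  rw [mass, ← integral_const_mul, ← integral_indicator measurableSet_ball]
  congr 1
  ext x
  by_cases hx : ‖x‖ < s
  · rw [indicator_of_mem (s := Ioi _) hx, indicator_of_mem (mem_ball_zero_iff.2 hx), mul_comm]
  · rw [indicator_of_notMem (s := Ioi _) hx,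
      indicator_of_notMem (fun h => hx (mem_ball_zero_iff.1 h)), mul_zero]

/-! ### The radial identity on annuli -/

theorem mem_annulus {a b : ℝ} {x : E3} : x ∈ annulus a b ↔ a < ‖x‖ ∧ ‖x‖ < b := by
  simp [annulus, and_comm]

theorem measurableSet_annulus {a b : ℝ} : MeasurableSet (annulus a b) :=
  measurableSet_ball.diff measurableSet_closedBall

theorem mass_nonneg (u : E3 → E3) (s : ℝ) : 0 ≤ mass u s :=
  integral_nonneg fun _ => by positivity

theorem IsWeakBeltrami.integrableOn_ball {u : E3 → E3} (hu : IsWeakBeltrami u) (s : ℝ) :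
    IntegrableOn (fun x => ‖u x‖ ^ 2) (ball 0 s) :=
  (hu.locallyIntegrable_norm_sq.integrableOn_isCompact
    (isCompact_closedBall 0 s)).mono_set ball_subset_closedBall

theorem IsWeakBeltrami.monotone_mass {u : E3 → E3} (hu : IsWeakBeltrami u) :
    Monotone (mass u) := fun _ t hst =>
  setIntegral_mono_set (hu.integrableOn_ball t) (Eventually.of_forall fun _ => by positivity)
    (ball_subset_ball hst).eventuallyLE

theorem IsWeakBeltrami.integrableOn_gap_mul {u : E3 → E3} (hu : IsWeakBeltrami u) {w : ℝ → ℝ}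
    {a b : ℝ} (hw : ContinuousOn w (Icc a b)) :
    IntegrableOn (fun x => gap u x * w ‖x‖) (annulus a b) := by
  have hK : IsCompact (closedBall (0 : E3) b \ ball 0 a) :=
    (isCompact_closedBall 0 b).diff isOpen_ball
  have h : IntegrableOn (fun x => gap u x * w ‖x‖) (closedBall (0 : E3) b \ ball 0 a) :=
    (hu.locallyIntegrable_gap.integrableOn_isCompact hK).mul_continuousOn
      (hw.comp continuous_norm.continuousOn fun x hx => by simpa [and_comm] using hx) hK
  exact h.mono_set (sdiff_subset_sdiff ball_subset_closedBall ball_subset_closedBall)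

/-- Smooth cut-offs converging to the indicator function of `(a, b)`. -/
noncomputable def cutoff (a b : ℝ) (n : ℕ) (r : ℝ) : ℝ :=
  Real.smoothTransition (n * (r - a)) * Real.smoothTransition (n * (b - r))

theorem contDiff_cutoff (a b : ℝ) (n : ℕ) : ContDiff ℝ ∞ (cutoff a b n) :=
  (Real.smoothTransition.contDiff.comp (contDiff_const.mul (contDiff_id.sub contDiff_const))).mul
    (Real.smoothTransition.contDiff.comp (contDiff_const.mul (contDiff_const.sub contDiff_id)))

theorem cutoff_of_le_left {a b : ℝ} (n : ℕ) {r : ℝ} (h : r ≤ a) : cutoff a b n r = 0 := by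
  rw [cutoff, Real.smoothTransition.zero_of_nonpos, zero_mul]
  exact mul_nonpos_of_nonneg_of_nonpos (by positivity) (by linarith)

theorem cutoff_of_ge_right {a b : ℝ} (n : ℕ) {r : ℝ} (h : b ≤ r) : cutoff a b n r = 0 := by
  rw [cutoff, Real.smoothTransition.zero_of_nonpos (x := n * (b - r)), mul_zero]
  exact mul_nonpos_of_nonneg_of_nonpos (by positivity) (by linarith)

theorem abs_cutoff_le (a b : ℝ) (n : ℕ) (r : ℝ) : |cutoff a b n r| ≤ 1 := by
  rw [cutoff, abs_of_nonneg (mul_nonneg (Real.smoothTransition.nonneg _)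
    (Real.smoothTransition.nonneg _))]
  exact mul_le_one₀ (Real.smoothTransition.le_one _) (Real.smoothTransition.nonneg _)
    (Real.smoothTransition.le_one _)

theorem tendsto_cutoff {a b r : ℝ} (h : r ∈ Ioo a b) :
    Tendsto (fun n => cutoff a b n r) atTop (𝓝 1) := by
  have e : ∀ c : ℝ, 0 < c → ∀ᶠ n : ℕ in atTop, (1 : ℝ) ≤ n * c := fun c hc =>
    (tendsto_natCast_atTop_atTop.atTop_mul_const hc).eventually_ge_atTop 1
  refine tendsto_const_nhds.congr' ?_
  filter_upwards [e (r - a) (by linarith [h.1]), e (b - r) (by linarith [h.2])] with n h1 h2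
  rw [cutoff, Real.smoothTransition.one_of_one_le h1, Real.smoothTransition.one_of_one_le h2,
    one_mul]

/-- The radial identity on annuli. -/
theorem integral_annulus_gap_mul_eq {u : E3 → E3} (hu : IsWeakBeltrami u) {w : ℝ → ℝ}
    {a b c : ℝ} (hc : 0 ≤ c) (hca : c < a) (hab : a ≤ b) (hw : ContDiffOn ℝ ∞ w (Ioi c)) :
    ∫ x in annulus a b, gap u x * w ‖x‖ = ∫ s in a..b, w s * (mass u s / s) := by
  have ha : 0 < a := hc.trans_lt hca
  have hIcc : Icc a b ⊆ Ioi c := fun s hs => hca.trans_le hs.1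
  have hwc : ContinuousOn w (Icc a b) := hw.continuousOn.mono hIcc
  -- The smooth identity carries the weight `|x| k(|x|)`, so `k` must approximate `w(r)/r`. The
  -- cut-off vanishes up to `a > c`, hence the product extends smoothly by zero.
  set κ : ℝ → ℝ := fun r => w r / r with hκ
  have hκc : ContDiffOn ℝ ∞ κ (Ioi c) :=
    hw.div contDiffOn_id fun s hs => (hc.trans_lt hs).ne'
  have hkc : ∀ n, ContDiff ℝ ∞ fun r => cutoff a b n r * κ r := by
    intro n
    refine contDiff_iff_contDiffAt.2 fun r => ?_
    rcases lt_or_ge c r with h | h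
    · exact (contDiff_cutoff a b n).contDiffAt.mul (hκc.contDiffAt (Ioi_mem_nhds h))
    · refine (contDiffAt_const (c := (0 : ℝ))).congr_of_eventuallyEq ?_
      filter_upwards [Iio_mem_nhds (h.trans_lt hca)] with s hs
      rw [cutoff_of_le_left n (le_of_lt hs), zero_mul]
  have key : ∀ n, ∫ x, gap u x * (‖x‖ * (cutoff a b n ‖x‖ * κ ‖x‖)) =
      ∫ s, cutoff a b n s * κ s * mass u s := fun n =>
    integral_gap_mul_eq_of_contDiff hu ha (hkc n)
      (fun s hs => by rw [cutoff_of_le_left n hs, zero_mul])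
      (fun s hs => by rw [cutoff_of_ge_right n hs, zero_mul])
  have i1 : Integrable ((annulus a b).indicator fun x => gap u x * w ‖x‖) :=
    (integrable_indicator_iff measurableSet_annulus).2 (hu.integrableOn_gap_mul hwc)
  have i2 : Integrable ((Ioo a b).indicator fun s => κ s * mass u s) := by
    rw [integrable_indicator_iff measurableSet_Ioo]
    have hm : IntegrableOn (mass u) (Icc a b) :=
      (hu.monotone_mass.monotoneOn _).integrableOn_isCompact isCompact_Icc
    exact (hm.continuousOn_mul (hκc.continuousOn.mono hIcc) isCompact_Icc).mono_set
      Ioo_subset_Icc_self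
  have e1 : ∀ n x, gap u x * (‖x‖ * (cutoff a b n ‖x‖ * κ ‖x‖)) =
      cutoff a b n ‖x‖ * (annulus a b).indicator (fun x => gap u x * w ‖x‖) x := by
    intro n x
    by_cases hx : x ∈ annulus a b
    · have h0 : ‖x‖ ≠ 0 := (ha.trans (mem_annulus.1 hx).1).ne'
      rw [indicator_of_mem hx]; simp only [hκ]; field_simp
    · rw [indicator_of_notMem hx]
      rw [mem_annulus, not_and_or, not_lt, not_lt] at hx
      rw [hx.elim (fun h => cutoff_of_le_left n h) (fun h => cutoff_of_ge_right n h)]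
      ring
  have e2 : ∀ n s, cutoff a b n s * κ s * mass u s =
      cutoff a b n s * (Ioo a b).indicator (fun s => κ s * mass u s) s := by
    intro n s
    by_cases hs : s ∈ Ioo a b
    · rw [indicator_of_mem hs]; ring
    · rw [indicator_of_notMem hs]
      rw [mem_Ioo, not_and_or, not_lt, not_lt] at hs
      rw [hs.elim (fun h => cutoff_of_le_left n h) (fun h => cutoff_of_ge_right n h)]
      ring
  simp only [e1, e2] at key
  -- Dominated convergence: the cut-offs are bounded by one, tend to one on the open annulus and
  -- vanish off it.
  have L1 : Tendsto (fun n => ∫ x, cutoff a b n ‖x‖ *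
      (annulus a b).indicator (fun x => gap u x * w ‖x‖) x) atTop
      (𝓝 (∫ x, (annulus a b).indicator (fun x => gap u x * w ‖x‖) x)) := by
    refine tendsto_integral_of_dominated_convergence _ (fun n => ?_) i1.norm (fun n => ?_) ?_
    · exact ((contDiff_cutoff a b n).continuous.comp
        continuous_norm).aestronglyMeasurable.mul i1.1
    · refine Eventually.of_forall fun x => ?_
      rw [norm_mul]
      exact mul_le_of_le_one_left (norm_nonneg _) (abs_cutoff_le a b n _)
    · refine Eventually.of_forall fun x => ?_
      by_cases hx : x ∈ annulus a b
      · simpa using (tendsto_cutoff (mem_annulus.1 hx)).mul_const _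
      · simp [indicator_of_notMem hx]
  have L2 : Tendsto (fun n => ∫ s, cutoff a b n s *
      (Ioo a b).indicator (fun s => κ s * mass u s) s) atTop
      (𝓝 (∫ s, (Ioo a b).indicator (fun s => κ s * mass u s) s)) := by
    refine tendsto_integral_of_dominated_convergence _ (fun n => ?_) i2.norm (fun n => ?_) ?_
    · exact (contDiff_cutoff a b n).continuous.aestronglyMeasurable.mul i2.1
    · refine Eventually.of_forall fun x => ?_
      rw [norm_mul]
      exact mul_le_of_le_one_left (norm_nonneg _) (abs_cutoff_le a b n _)
    · refine Eventually.of_forall fun s => ?_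
      by_cases hs : s ∈ Ioo a b
      · simpa using (tendsto_cutoff hs).mul_const _
      · simp [indicator_of_notMem hs]
  have := tendsto_nhds_unique (L1.congr key) L2
  rw [integral_indicator measurableSet_annulus, integral_indicator measurableSet_Ioo] at this
  rw [this, intervalIntegral.integral_of_le hab, integral_Ioc_eq_integral_Ioo]
  refine setIntegral_congr_fun measurableSet_Ioo fun s _ => ?_
  simp only [hκ]
  ring

/-! ### Monotonicity of the normalized mass -/

theorem IsWeakBeltrami.mass_mul_log_le {u : E3 → E3} (hu : IsWeakBeltrami u) {a b : ℝ}
    (ha : 0 < a) (hab : a ≤ b) : mass u a * (1 + Real.log (b / a)) ≤ mass u b := by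
  have hb : 0 < b := ha.trans_le hab
  have h1 := integral_annulus_gap_mul_eq hu (w := fun _ => 1) le_rfl ha hab contDiffOn_const
  simp only [mul_one, one_mul] at h1
  -- Upper bound for the left side of the identity with weight one, from `gap ≤ |u|²`.
  have h2 : ∫ x in annulus a b, gap u x ≤ mass u b - mass u a := by
    have hi : IntegrableOn (gap u) (annulus a b) := by
      simpa using hu.integrableOn_gap_mul (w := fun _ => 1) (a := a) (b := b) continuousOn_const
    have hd : MeasurableSet (ball (0 : E3) b \ ball 0 a) :=
      measurableSet_ball.diff measurableSet_ball
    have hsub : annulus a b ⊆ ball (0 : E3) b \ ball 0 a :=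
      sdiff_subset_sdiff subset_rfl ball_subset_closedBall
    have hi2 : IntegrableOn (fun x => ‖u x‖ ^ 2) (ball (0 : E3) b \ ball 0 a) :=
      (hu.integrableOn_ball b).mono_set sdiff_subset
    calc ∫ x in annulus a b, gap u x ≤ ∫ x in annulus a b, ‖u x‖ ^ 2 :=
          integral_mono hi (hi2.mono_set hsub) fun x => (le_abs_self _).trans (abs_gap_le u x)
      _ ≤ ∫ x in ball (0 : E3) b \ ball 0 a, ‖u x‖ ^ 2 :=
          setIntegral_mono_set hi2 (Eventually.of_forall fun _ => by positivity) hsub.eventuallyLE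
      _ = mass u b - mass u a :=
          setIntegral_sdiff measurableSet_ball (hu.integrableOn_ball b) (ball_subset_ball hab)
  -- Lower bound for its right side, as the mass is at least `mass u a` on `[a, b]`.
  have h3 : mass u a * Real.log (b / a) ≤ ∫ s in a..b, mass u s / s := by
    rw [← integral_inv_of_pos ha hb, ← intervalIntegral.integral_const_mul]
    have hc : ContinuousOn (fun s : ℝ => s⁻¹) (uIcc a b) := by
      rw [uIcc_of_le hab]
      exact continuousOn_inv₀.mono fun s hs => (ha.trans_le hs.1).ne'
    refine intervalIntegral.integral_mono_on hab (hc.intervalIntegrable.const_mul _) ?_ ?_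
    · simp only [div_eq_mul_inv]
      exact ((hu.monotone_mass.monotoneOn _).intervalIntegrable).mul_continuousOn hc
    · intro s hs
      rw [div_eq_mul_inv]
      have : 0 < s := ha.trans_le hs.1
      gcongr
      exact hu.monotone_mass hs.1
  linarith

/-- The monotonicity of `s⁻¹ ∫_{B_s} |u|²`. -/
theorem IsWeakBeltrami.monotoneOn_mass_div {u : E3 → E3} (hu : IsWeakBeltrami u) :
    MonotoneOn (fun s => mass u s / s) (Ioi 0) := by
  intro a ha b hb hab
  simp only [mem_Ioi] at ha hb
  set L := Real.log (b / a) with hL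
  have hL0 : 0 ≤ L := Real.log_nonneg (by rwa [one_le_div ha])
  -- The logarithmic bound is iterated over `n` geometric steps of ratio `exp (L / n)`. In the limit
  -- `(1 + L/n)^n` becomes `exp L = b / a`, the sharp factor, without differentiating the mass.
  have hstep : ∀ n : ℕ, 0 < n → mass u a * (1 + L / n) ^ n ≤ mass u b := by
    intro n hn
    have hn' : (n : ℝ) ≠ 0 := by positivity
    set q := Real.exp (L / n) with hq
    have hq1 : 1 ≤ q := Real.one_le_exp (by positivity)
    have hk : ∀ k : ℕ, mass u a * (1 + L / n) ^ k ≤ mass u (a * q ^ k) := by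
      intro k
      induction k with
      | zero => simp
      | succ k ih =>
        have hpos : 0 < a * q ^ k := by positivity
        have h := hu.mass_mul_log_le hpos
          (le_mul_of_one_le_right hpos.le hq1 : a * q ^ k ≤ a * q ^ k * q)
        rw [mul_div_cancel_left₀ _ hpos.ne', hq, Real.log_exp, ← hq] at h
        calc mass u a * (1 + L / n) ^ (k + 1) = mass u a * (1 + L / n) ^ k * (1 + L / n) := by ring
          _ ≤ mass u (a * q ^ k) * (1 + L / n) := by gcongr
          _ ≤ mass u (a * q ^ (k + 1)) := by rw [pow_succ, ← mul_assoc]; exact h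
    have hqn : a * q ^ n = b := by
      rw [hq, ← Real.exp_nat_mul, mul_div_cancel₀ _ hn', hL, Real.exp_log (by positivity)]
      field_simp
    simpa [hqn] using hk n
  have hlim : Tendsto (fun n : ℕ => mass u a * (1 + L / n) ^ n) atTop
      (𝓝 (mass u a * Real.exp L)) := (Real.tendsto_one_add_div_pow_exp L).const_mul _
  have := le_of_tendsto hlim ((eventually_gt_atTop 0).mono hstep)
  rw [hL, Real.exp_log (by positivity)] at this
  rw [div_le_div_iff₀ ha hb]
  have h2 : mass u a * (b / a) * a = mass u a * b := by field_simp
  nlinarith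

/-! ### Weighted averages -/

/-- Weighted averages over `[a, R]` of a monotone function are monotone in `R`. -/
theorem average_le_average {ψ w W : ℝ → ℝ} {a R S : ℝ} (hψ : MonotoneOn ψ (Icc a S))
    (haR : a < R) (hRS : R ≤ S) (hw : ContinuousOn w (Icc a S)) (hw0 : ∀ s ∈ Icc a S, 0 ≤ w s)
    (hW : ∀ t ∈ Icc R S, ∫ s in a..t, w s = W t) (hWR : 0 < W R) :
    (∫ s in a..R, w s * ψ s) / W R ≤ (∫ s in a..S, w s * ψ s) / W S := by
  have haS : a ≤ S := haR.le.trans hRS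
  have hsub : ∀ {p q : ℝ}, a ≤ p → p ≤ q → q ≤ S → uIcc p q ⊆ Icc a S := fun h1 h2 h3 => by
    rw [uIcc_of_le h2]; exact Icc_subset_Icc h1 h3
  have iw : ∀ {p q : ℝ}, a ≤ p → p ≤ q → q ≤ S → IntervalIntegrable w volume p q :=
    fun h1 h2 h3 => (hw.mono (hsub h1 h2 h3)).intervalIntegrable
  have iwψ : ∀ {p q : ℝ}, a ≤ p → p ≤ q → q ≤ S →
      IntervalIntegrable (fun s => w s * ψ s) volume p q := fun h1 h2 h3 =>
    (hψ.mono (hsub h1 h2 h3)).intervalIntegrable.continuousOn_mul (hw.mono (hsub h1 h2 h3))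
  have hRm : R ∈ Icc a S := ⟨haR.le, hRS⟩
  -- The value `ψ R` separates the two pieces: it bounds `ψ` from above on `[a, R]` and from below
  -- on `[R, S]`.
  have h1 : ∫ s in a..R, w s * ψ s ≤ W R * ψ R := by
    rw [← hW R ⟨le_rfl, hRS⟩, ← intervalIntegral.integral_mul_const]
    refine intervalIntegral.integral_mono_on haR.le (iwψ le_rfl haR.le hRS)
      ((iw le_rfl haR.le hRS).mul_const _) fun s hs => ?_
    have hs' : s ∈ Icc a S := ⟨hs.1, hs.2.trans hRS⟩
    exact mul_le_mul_of_nonneg_left (hψ hs' hRm hs.2) (hw0 s hs')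
  have h2 : (W S - W R) * ψ R ≤ ∫ s in R..S, w s * ψ s := by
    rw [← hW R ⟨le_rfl, hRS⟩, ← hW S ⟨hRS, le_rfl⟩,
      intervalIntegral.integral_interval_sub_left (iw le_rfl haS le_rfl) (iw le_rfl haR.le hRS),
      ← intervalIntegral.integral_mul_const]
    refine intervalIntegral.integral_mono_on hRS ((iw haR.le hRS le_rfl).mul_const _)
      (iwψ haR.le hRS le_rfl) fun s hs => ?_
    have hs' : s ∈ Icc a S := ⟨haR.le.trans hs.1, hs.2⟩
    exact mul_le_mul_of_nonneg_left (hψ hRm hs' hs.1) (hw0 s hs')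
  have h3 : W R ≤ W S := by
    rw [← hW R ⟨le_rfl, hRS⟩, ← hW S ⟨hRS, le_rfl⟩, ← sub_nonneg,
      intervalIntegral.integral_interval_sub_left (iw le_rfl haS le_rfl) (iw le_rfl haR.le hRS)]
    exact intervalIntegral.integral_nonneg hRS fun s hs => hw0 s ⟨haR.le.trans hs.1, hs.2⟩
  rw [← intervalIntegral.integral_add_adjacent_intervals (iwψ le_rfl haR.le hRS)
    (iwψ haR.le hRS le_rfl), div_le_div_iff₀ hWR (hWR.trans_le h3)]
  nlinarith [mul_le_mul_of_nonneg_left h1 (sub_nonneg.2 h3), mul_le_mul_of_nonneg_left h2 hWR.le]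

/-- The radial identity makes the quotient a `w`-weighted average of `mass u s / s`: `W` is the
primitive of `w` vanishing at `a`. The margin `c < a` keeps the weight smooth across the inner
radius. -/
theorem IsWeakBeltrami.energy_average {u : E3 → E3} (hu : IsWeakBeltrami u) {w W : ℝ → ℝ}
    {a c : ℝ} (hc : 0 ≤ c) (hca : c < a) (hw : ContDiffOn ℝ ∞ w (Ioi c))
    (hw0 : ∀ s, a ≤ s → 0 ≤ w s) (hW : ∀ s, a ≤ s → HasDerivAt W (w s) s) (hWa : W a = 0)
    (hWpos : ∀ s, a < s → 0 < W s) :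
    MonotoneOn (fun R => (∫ x in annulus a R, gap u x * w ‖x‖) / W R) (Ioi a) := by
  intro R hR S hS hRS
  simp only [mem_Ioi] at hR hS
  simp only
  rw [integral_annulus_gap_mul_eq hu hc hca hR.le hw,
    integral_annulus_gap_mul_eq hu hc hca hS.le hw]
  have hwc : ∀ t, ContinuousOn w (Icc a t) := fun t =>
    hw.continuousOn.mono fun s hs => hca.trans_le hs.1
  refine average_le_average (ψ := fun s => mass u s / s)
    (hu.monotoneOn_mass_div.mono fun s hs => (hc.trans_lt hca).trans_le hs.1) hR hRS (hwc S)
    (fun s hs => hw0 s hs.1) (fun t ht => ?_) (hWpos R hR)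
  have hat : a ≤ t := hR.le.trans ht.1
  rw [intervalIntegral.integral_eq_sub_of_hasDerivAt (f := W), hWa, sub_zero]
  · intro s hs
    rw [uIcc_of_le hat] at hs
    exact hW s hs.1
  · refine ContinuousOn.intervalIntegrable ?_
    rw [uIcc_of_le hat]
    exact hwc t

theorem IsWeakBeltrami.integral_gap_mul_nonneg {u : E3 → E3} (hu : IsWeakBeltrami u) {w : ℝ → ℝ}
    {a b c : ℝ} (hc : 0 ≤ c) (hca : c < a) (hab : a ≤ b) (hw : ContDiffOn ℝ ∞ w (Ioi c))
    (hw0 : ∀ s, a ≤ s → 0 ≤ w s) : 0 ≤ ∫ x in annulus a b, gap u x * w ‖x‖ := by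
  rw [integral_annulus_gap_mul_eq hu hc hca hab hw]
  refine intervalIntegral.integral_nonneg hab fun s hs => mul_nonneg (hw0 s hs.1) ?_
  exact div_nonneg (mass_nonneg u s) ((hc.trans_lt hca).le.trans hs.1)

theorem IsWeakBeltrami.integrableOn_gap_mul_of_contDiffOn {u : E3 → E3} (hu : IsWeakBeltrami u)
    {w : ℝ → ℝ} {a b c : ℝ} (hca : c < a) (hw : ContDiffOn ℝ ∞ w (Ioi c)) :
    IntegrableOn (fun x => gap u x * w ‖x‖) (annulus a b) :=
  hu.integrableOn_gap_mul (hw.continuousOn.mono fun _ hs => hca.trans_le hs.1)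

/-! ### The four energies -/

theorem IsWeakBeltrami.monotoneOn_energy1 {u : E3 → E3} (hu : IsWeakBeltrami u) :
    MonotoneOn (energy1 u) (Ioi 0) := by
  have hψ := hu.monotoneOn_mass_div
  -- Both radii move with `R`; rescaling fixes the interval and leaves an integrand that is
  -- pointwise non-decreasing in `R`.
  have h : ∀ R, 0 < R → energy1 u R = ∫ s in (1 : ℝ)..2, mass u (R * s) / (R * s) := by
    intro R hR
    have h1 := integral_annulus_gap_mul_eq hu (w := fun _ => 1) (b := 2 * R) le_rfl hR
      (by linarith) contDiffOn_const
    simp only [mul_one, one_mul] at h1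
    rw [energy1, h1, intervalIntegral.integral_comp_mul_left (fun s => mass u s / s) hR.ne']
    simp [mul_comm]
  have hm : ∀ R, 0 < R → MonotoneOn (fun s => mass u (R * s) / (R * s)) (uIcc 1 2) := by
    intro R hR s hs t ht hst
    rw [uIcc_of_le one_le_two] at hs ht
    have h1 : 0 < s := one_pos.trans_le hs.1
    have h2 : 0 < t := one_pos.trans_le ht.1
    exact hψ (mul_pos hR h1) (mul_pos hR h2) (mul_le_mul_of_nonneg_left hst hR.le)
  intro R hR S hS hRS
  rw [h R hR, h S hS]
  refine intervalIntegral.integral_mono_on one_le_two (hm R hR).intervalIntegrable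
    (hm S hS).intervalIntegrable fun s hs => ?_
  have h1 : 0 < s := one_pos.trans_le hs.1
  exact hψ (mul_pos hR h1) (mul_pos hS h1) (mul_le_mul_of_nonneg_right hRS h1.le)

theorem contDiffOn_inv_Ioi : ContDiffOn ℝ ∞ (fun r : ℝ => r⁻¹) (Ioi 0) :=
  contDiffOn_id.inv fun _ hr => (ne_of_gt hr)

theorem contDiffOn_weight (β : ℝ) :
    ContDiffOn ℝ ∞ (fun r : ℝ => (r * Real.log r ^ β)⁻¹) (Ioi 1) := by
  have hl : ContDiffOn ℝ ∞ Real.log (Ioi 1) :=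
    Real.contDiffOn_log.mono fun r hr => (one_pos.trans hr).ne'
  refine (contDiffOn_id.mul (hl.rpow_const_of_ne fun r hr => (Real.log_pos hr).ne')).inv
    fun r hr => ?_
  exact (mul_pos (one_pos.trans hr) (Real.rpow_pos_of_pos (Real.log_pos hr) _)).ne'

theorem weight_nonneg (β : ℝ) {r : ℝ} (hr : 1 ≤ r) : 0 ≤ (r * Real.log r ^ β)⁻¹ :=
  inv_nonneg.2 (mul_nonneg (by linarith) (Real.rpow_nonneg (Real.log_nonneg hr) _))

theorem IsWeakBeltrami.monotoneOn_energy2 {u : E3 → E3} (hu : IsWeakBeltrami u) :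
    MonotoneOn (energy2 u) (Ioi 1) := by
  have := hu.energy_average (W := Real.log) le_rfl one_pos contDiffOn_inv_Ioi
    (fun s hs => by positivity) (fun s hs => Real.hasDerivAt_log (by positivity)) Real.log_one
    (fun s hs => Real.log_pos hs)
  refine this.congr fun R _ => ?_
  simp only [energy2, div_eq_mul_inv]
  ring

theorem one_lt_exp_one : (1 : ℝ) < Real.exp 1 := Real.one_lt_exp_iff.2 one_pos

theorem one_le_log_of_exp_le {s : ℝ} (hs : Real.exp 1 ≤ s) : 1 ≤ Real.log s :=
  (Real.le_log_iff_exp_le ((Real.exp_pos 1).trans_le hs)).2 hs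

theorem one_lt_log_of_exp_lt {s : ℝ} (hs : Real.exp 1 < s) : 1 < Real.log s :=
  (Real.lt_log_iff_exp_lt ((Real.exp_pos 1).trans hs)).2 hs

theorem IsWeakBeltrami.monotoneOn_energy4 {u : E3 → E3} (hu : IsWeakBeltrami u) :
    MonotoneOn (energy4 u) (Ioi (Real.exp 1)) := by
  have hpos : ∀ s, Real.exp 1 ≤ s → 0 < s := fun s hs => (Real.exp_pos 1).trans_le hs
  have := hu.energy_average (W := fun s => Real.log (Real.log s)) zero_le_one one_lt_exp_one
    (contDiffOn_weight 1) (fun s hs => weight_nonneg 1 (one_lt_exp_one.le.trans hs))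
    (fun s hs => ?_) (by simp) (fun s hs => Real.log_pos (one_lt_log_of_exp_lt hs))
  · refine this.congr fun R _ => ?_
    simp only [energy4, div_eq_mul_inv, Real.rpow_one]
    ring
  · have h0 := one_le_log_of_exp_le hs
    convert! (Real.hasDerivAt_log (hpos s hs).ne').log (by positivity) using 1
    rw [Real.rpow_one, mul_inv, div_eq_mul_inv]

/-- The normalizer `log^{1-β} R` is not the integral `W` of the weight from `e`, which is
`(log^{1-β} R - 1)/(1-β)`. The correcting factor `(1 - log^{β-1} R)/(1-β)` is non-negative and
non-decreasing, and so is the average by non-negativity of its numerator; hence the product is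
non-decreasing. -/
theorem IsWeakBeltrami.monotoneOn_energy3 {u : E3 → E3} (hu : IsWeakBeltrami u) {β : ℝ}
    (hβ : β < 1) : MonotoneOn (energy3 u β) (Ioi (Real.exp 1)) := by
  have hpos : ∀ s, Real.exp 1 ≤ s → 0 < s := fun s hs => (Real.exp_pos 1).trans_le hs
  have hγ : 0 < 1 - β := by linarith
  set W : ℝ → ℝ := fun s => (Real.log s ^ (1 - β) - 1) / (1 - β) with hW
  have hone : ∀ s, Real.exp 1 < s → 1 < Real.log s ^ (1 - β) := fun s hs =>
    Real.one_lt_rpow (one_lt_log_of_exp_lt hs) hγ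
  have hWpos : ∀ s, Real.exp 1 < s → 0 < W s := fun s hs =>
    div_pos (by linarith [hone s hs]) hγ
  have hw0 : ∀ s, Real.exp 1 ≤ s → 0 ≤ (s * Real.log s ^ β)⁻¹ := fun s hs =>
    weight_nonneg β (one_lt_exp_one.le.trans hs)
  have hmono := hu.energy_average (W := W) zero_le_one one_lt_exp_one
    (contDiffOn_weight β) hw0 (fun s hs => ?_) (by simp [hW]) hWpos
  · have heq : ∀ R, Real.exp 1 < R → energy3 u β R =
        (∫ x in annulus (Real.exp 1) R, gap u x * (‖x‖ * Real.log ‖x‖ ^ β)⁻¹) / W R *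
          ((1 - (Real.log R ^ (1 - β))⁻¹) / (1 - β)) := by
      intro R hR
      have h1 := hone R hR
      have h2 := (hWpos R hR).ne'
      have h3 : Real.log R ^ (1 - β) - 1 ≠ 0 := by linarith
      have h4 : Real.log R ^ (1 - β) ≠ 0 := by linarith
      simp only [energy3, hW]
      simp only [div_eq_mul_inv (gap u _)]
      field_simp
    intro R hR S hS hRS
    simp only [mem_Ioi] at hR hS
    rw [heq R hR, heq S hS]
    have h1 := hone R hR
    have h12 : Real.log R ^ (1 - β) ≤ Real.log S ^ (1 - β) :=
      Real.rpow_le_rpow (by linarith [one_lt_log_of_exp_lt hR])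
        (Real.log_le_log (hpos R hR.le) hRS) hγ.le
    refine mul_le_mul (hmono hR hS hRS) ?_ ?_ ?_
    · gcongr
    · exact div_nonneg (sub_nonneg.2 (inv_le_one_of_one_le₀ h1.le)) hγ.le
    · exact div_nonneg (hu.integral_gap_mul_nonneg zero_le_one one_lt_exp_one hS.le
        (contDiffOn_weight β) hw0) (hWpos S hS).le
  · have h0 : 0 < Real.log s := one_pos.trans_le (one_le_log_of_exp_le hs)
    have hs0 := hpos s hs
    have h := (((Real.hasDerivAt_log hs0.ne').rpow_const (p := 1 - β)
      (Or.inl h0.ne')).sub_const 1).div_const (1 - β)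
    convert! h using 1
    rw [show 1 - β - 1 = -β by ring, Real.rpow_neg h0.le]
    field_simp

end Beltrami

theorem proposition1 (u : Beltrami.E3 → Beltrami.E3) (hu : Beltrami.IsWeakBeltrami u) :
    ((∀ R : ℝ, 0 < R → IntegrableOn (Beltrami.gap u) (Beltrami.annulus R (2 * R))) ∧
      MonotoneOn (Beltrami.energy1 u) (Ioi 0)) ∧
    ((∀ R : ℝ, 1 < R → IntegrableOn (fun x => Beltrami.gap u x / ‖x‖) (Beltrami.annulus 1 R)) ∧
      MonotoneOn (Beltrami.energy2 u) (Ioi 1)) ∧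
    (∀ β : ℝ, β < 1 →
      (∀ R : ℝ, Real.exp 1 < R →
        IntegrableOn (fun x => Beltrami.gap u x / (‖x‖ * Real.log ‖x‖ ^ β))
          (Beltrami.annulus (Real.exp 1) R)) ∧
      MonotoneOn (Beltrami.energy3 u β) (Ioi (Real.exp 1))) ∧
    ((∀ R : ℝ, Real.exp 1 < R →
        IntegrableOn (fun x => Beltrami.gap u x / (‖x‖ * Real.log ‖x‖))
          (Beltrami.annulus (Real.exp 1) R)) ∧
      MonotoneOn (Beltrami.energy4 u) (Ioi (Real.exp 1))) := by
  refine ⟨⟨fun R hR => ?_, hu.monotoneOn_energy1⟩, ⟨fun R _ => ?_, hu.monotoneOn_energy2⟩,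
    fun β hβ => ⟨fun R _ => ?_, hu.monotoneOn_energy3 hβ⟩, fun R _ => ?_, hu.monotoneOn_energy4⟩
  · simpa using hu.integrableOn_gap_mul_of_contDiffOn (w := fun _ => 1) (b := 2 * R) hR
      contDiffOn_const
  · simpa only [div_eq_mul_inv] using
      hu.integrableOn_gap_mul_of_contDiffOn one_pos Beltrami.contDiffOn_inv_Ioi
  · simpa only [div_eq_mul_inv] using
      hu.integrableOn_gap_mul_of_contDiffOn Beltrami.one_lt_exp_one (Beltrami.contDiffOn_weight β)
  · simpa only [div_eq_mul_inv, Real.rpow_one] using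
      hu.integrableOn_gap_mul_of_contDiffOn Beltrami.one_lt_exp_one (Beltrami.contDiffOn_weight 1)
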